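/- **Property graphs.** Fix sets of labels, keys and constants. A *property graph* $G$ has finite sets $N$, $E_d$, $E_u$ of nodes, directed edges and undirected edges; a finite set of labels $\lambda(o)$ for every node or edge $o$; maps $\mathsf{src},\mathsf{tgt}:E_d\to N$; a map $\mathsf{endpoints}$ sending each undirected edge to a set of one or two nodes; and a partial function $\delta$ assigning constants to pairs (node or edge, key). A path is an alternating sequence $u_0e_1u_1\cdots e_nu_n$ ($n\ge 0$) of nodes and edges. **GPC.** Fix a countably infinite set of variables. *Patterns* are given by $$\pi ::= (d)\mid \xrightarrow{d}\mid\xleftarrow{d}\mid\overset{d}{-\!\!-}\mid \pi+\pi\mid \pi\,\pi\mid \pi\langle\theta\rangle\mid \pi^{n..m}\qquad(0\le n\le m\le\infty),$$ where the descriptor $d$ consists of an optional variable and an optional label, and $\theta$ is a Boolean combination of conditions $x.a=c$ and $x.a=y.b$. *Queries* are $Q::=\rho\,\pi\mid x=\rho\,\pi\mid Q,Q$ with a restrictor $\rho$ among simple, trail, shortest, shortest simple, shortest trail. *Typing.* A variable of a node (edge) pattern has type $\mathsf{Node}$ ($\mathsf{Edge}$). In $\pi^{n..m}$ a variable of type $\tau$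 in $\pi$ gets type $\mathsf{Group}(\tau)$. In $\pi_1+\pi_2$ a variable that has type $\tau$ on both sides keeps $\tau$; if it has type $\tau$ on one side and $\mathsf{Maybe}(\tau)$ on the other, it gets $\mathsf{Maybe}(\tau)$; if it has type $\tau$ on one side and does not occur on the other, it gets $\mathsf{Maybe}(\tau)$ (or $\tau$, if $\tau$ is already a $\mathsf{Maybe}$ type). In $\pi_1\pi_2$ and $Q_1,Q_2$ a variable inherits its type, and may occur on both sides only with the same type $\mathsf{Node}$ or $\mathsf{Edge}$. In $\pi\langle\theta\rangle$ the variables of $\theta$ must have type $\mathsf{Node}$ or $\mathsf{Edge}$ in $\pi$, and types are those in $\pi$. In $x=\rho\,\pi$ the variable $x$ must not occur in $\pi$ and has type $\mathsf{Path}$; restrictors do not change types. An expression is well-typed if each of its variables receives a type; queries below are well-typed. *Semantics.* $[\![\pi]\!]_G$ is a set of pairs $(p,\mu)$ of a path and an assignment of values to the variables of $\pi$. Node patterns match paths $u$ of length $0$, and edge patterns match paths $u\,e\,v$ with $e$ traversed forward, traversed backward, or undirected; the label, if present, must be carried by the element, and the variable, if present, is bound to it. Concatenation concatenates paths (the end of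 the first being the start of the second) and unites assignments that agree on common variables. In a union, a match of either side is a match, with the remaining variables set to $\mathsf{Nothing}$. $\pi\langle\theta\rangle$ keeps the matches satisfying $\theta$, where an atomic condition holds if the property values in it are defined and equal. $[\![\pi^{n..m}]\!]_G=\bigcup_{i=n}^m[\![\pi]\!]_G^i$, where $[\![\pi]\!]^0_G$ consists of all paths of length $0$ with every variable mapped to the empty list; for $i>0$, $[\![\pi]\!]^i_G$ is obtained from sequences $(p_1,\mu_1),\dots,(p_i,\mu_i)$ in $[\![\pi]\!]_G$ with concatenation $p=p_1\cdots p_i$ by merging each maximal run of consecutive matches with paths of length $0$ into one (allowed only if the assignments in the run agree pairwise), giving $(p'_1,\mu'_1),\dots,(p'_\ell,\mu'_\ell)$, and mapping each variable $x$ of $\pi$ to the list $((p'_1,\mu'_1(x)),\dots,(p'_\ell,\mu'_\ell(x)))$. Simple and trail keep the matches whose path repeats no node, resp. no edge; shortest keeps the matches whose path has minimal length among all matches (under the simple or trail restrictor, if combined with it) with the same two endpoints. $x=\rho\,\pi$ moreover binds $x$ to the path. $[\![Q_1,Q_2]\!]_G$ joins the tuples of paths and unites assignments that agree on common variables. **GPC+.**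 A *GPC+ query* is a nonempty finite set of rules $\mathrm{Ans}(\bar x)\,{:}{-}\,Q_1;\ \dots;\ \mathrm{Ans}(\bar x)\,{:}{-}\,Q_k$ with GPC queries $Q_i$ whose variables include those of the common tuple $\bar x$. Its set of answers on $G$ is $\bigcup_i\{\mu(\bar x)\mid \exists \bar p\ (\bar p,\mu)\in[\![Q_i]\!]_G\}$. **The other languages.** For a label $a$, let $a(u,v)$ hold in $G$ if there is a directed edge from $u$ to $v$ with label $a$, and let $a^-(u,v)$ mean $a(v,u)$. * A *2RPQ* is a regular expression $r$ over the letters $a,a^-$; $r(u,v)$ holds if some word of its language labels a path from $u$ to $v$. A *C2RPQ* is $\mathrm{Ans}(\bar x)\,{:}{-}\,r_1(y_1,z_1),\dots,r_m(y_m,z_m)$ with $m\ge1$, 2RPQs $r_i$, and all variables of $\bar x$ occurring in the body; its answers are the images of $\bar x$ under the maps from variables to nodes that satisfy the body. A *UC2RPQ* is a finite union of C2RPQs of the same arity. * *Nested regular expressions* are $e::=\varepsilon\mid a\mid a^-\mid e\cdot e\mid e+e\mid e^*\mid[e]$. They denote binary relations on $N$: identity, $a$, $a^-$, composition, union, reflexive-transitive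 closure, and $[e]=\{(u,u)\mid\exists v\ (u,v)\in e\}$. * A *regular query* is a finite nonrecursive Datalog program with a distinguished answer predicate of some arity $n\ge0$, whose rules have nonempty bodies, have all head variables occurring in the body, and are built from atoms $A(x)$ ($x$ is a node with label $A$), $a(x,y)$, $P(x_1,\dots,x_k)$ for user-defined predicates $P$ of any arity $k\ge 0$, and transitive atoms $a^+(x,y)$ and $P^+(x,y)$ with $P$ binary, which denote transitive closures. Its answers are the tuples of the answer predicate in the least model of the program on $G$. **Theorem.** For every UC2RPQ, every nested regular expression, and every regular query $q$, there is a GPC+ query $g$, of the same arity (arity $2$ for nested regular expressions), such that on every property graph $G$ the set of answers to $g$ equals the set of answers to $q$. -/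

import Mathlib

namespace GPC

/-! ### Property graphs -/

/-- A property graph.  The finite sets of node ids, directed edge ids and undirected edge ids used
in the graph are the finite types `N`, `Ed` and `Eu`; `L`, `K` and `C` are the sets of labels, keys
and constants.  An unordered pair in `Sym2 N` is a set of one or two nodes. -/
structure PropertyGraph (N Ed Eu L K C : Type*) where
  finite_nodes : Finite N
  finite_dedges : Finite Ed
  finite_uedges : Finite Eu
  label : N ⊕ (Ed ⊕ Eu) → Finset L
  src : Ed → N
  tgt : Ed → N
  endpoints : Eu → Sym2 N
  prop : N ⊕ (Ed ⊕ Eu) → K → Option C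

/-- The alternating sequence `u₀ e₁ u₁ ⋯ eₙ uₙ`, stored as `u₀` and the list of the pairs
`(eᵢ, uᵢ)`. -/
structure GPath (N Ed Eu : Type*) where
  src : N
  steps : List ((Ed ⊕ Eu) × N)

namespace GPath
variable {N Ed Eu : Type*}

/-- The path `path(u)` of length zero. -/
def single (u : N) : GPath N Ed Eu := ⟨u, []⟩

/-- The path `path(u, e, v)` of length one. -/
def edge (u : N) (e : Ed ⊕ Eu) (v : N) : GPath N Ed Eu := ⟨u, [(e, v)]⟩

/-- All node occurrences, in order. -/
def nodes (p : GPath N Ed Eu) : List N := p.src :: p.steps.map Prod.snd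

/-- All edge occurrences, in order. -/
def edges (p : GPath N Ed Eu) : List (Ed ⊕ Eu) := p.steps.map Prod.fst

/-- The last node. -/
def tgt (p : GPath N Ed Eu) : N := (p.steps.map Prod.snd).getLastD p.src

/-- The number of edge occurrences. -/
def len (p : GPath N Ed Eu) : ℕ := p.steps.length

/-- The two paths concatenate. -/
def Concatenates (p q : GPath N Ed Eu) : Prop := p.tgt = q.src

/-- The concatenation; only meaningful if the two paths concatenate. -/
def append (p q : GPath N Ed Eu) : GPath N Ed Eu := ⟨p.src, p.steps ++ q.steps⟩

end GPath

/-! ### Expressions of the calculus -/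

/-- The countably infinite set of variables. -/
abbrev Var := ℕ

/-- An optional variable and an optional label. -/
structure Descriptor (L : Type*) where
  var : Option Var
  label : Option L

inductive Direction where
  | forward
  | backward
  | undirected

inductive Condition (K C : Type*) where
  /-- `x.a = c` -/
  | eqConst (x : Var) (a : K) (c : C)
  /-- `x.a = y.b` -/
  | eqProp (x : Var) (a : K) (y : Var) (b : K)
  | and (θ₁ θ₂ : Condition K C)
  | or (θ₁ θ₂ : Condition K C)
  | not (θ : Condition K C)

inductive Restrictor where
  | simple
  | trail
  | shortest
  | shortestSimple
  | shortestTrail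

inductive Pattern (L K C : Type*) where
  | node (d : Descriptor L)
  | edge (dir : Direction) (d : Descriptor L)
  | union (π₁ π₂ : Pattern L K C)
  | concat (π₁ π₂ : Pattern L K C)
  | cond (π : Pattern L K C) (θ : Condition K C)
  /-- Repetition between `n` and `m` times, where `0 ≤ n ≤ m ≤ ∞`. -/
  | rep (π : Pattern L K C) (n : ℕ) (m : ℕ∞) (h : (n : ℕ∞) ≤ m)

inductive Query (L K C : Type*) where
  /-- `ρ π` -/
  | pat (ρ : Restrictor) (π : Pattern L K C)
  /-- `x = ρ π` -/
  | named (x : Var) (ρ : Restrictor) (π : Pattern L K C)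
  /-- `Q₁, Q₂` -/
  | join (Q₁ Q₂ : Query L K C)

section Syntactic
variable {L K C : Type*}

def Condition.vars : Condition K C → Finset Var
  | .eqConst x _ _ => {x}
  | .eqProp x _ y _ => {x, y}
  | .and θ₁ θ₂ => θ₁.vars ∪ θ₂.vars
  | .or θ₁ θ₂ => θ₁.vars ∪ θ₂.vars
  | .not θ => θ.vars

def Pattern.vars : Pattern L K C → Finset Var
  | .node d => d.var.toFinset
  | .edge _ d => d.var.toFinset
  | .union π₁ π₂ => π₁.vars ∪ π₂.vars
  | .concat π₁ π₂ => π₁.vars ∪ π₂.vars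
  | .cond π θ => π.vars ∪ θ.vars
  | .rep π _ _ _ => π.vars

def Query.vars : Query L K C → Finset Var
  | .pat _ π => π.vars
  | .named x _ π => {x} ∪ π.vars
  | .join Q₁ Q₂ => Q₁.vars ∪ Q₂.vars

/-! ### The type system -/

inductive Ty where
  | node
  | edge
  | path
  | maybe (τ : Ty)
  | group (τ : Ty)

/-- The type `τ?`. -/
def Ty.opt : Ty → Ty
  | .maybe τ => .maybe τ
  | τ => .maybe τ

/-- The types of singleton variables. -/
def Ty.IsSingleton (τ : Ty) : Prop := τ = .node ∨ τ = .edge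

/-- `θ` has type `Bool` when the variables are typed according to `Γ`. -/
def Condition.Typed (Γ : Var → Ty → Prop) : Condition K C → Prop
  | .eqConst x _ _ => ∃ τ, Γ x τ ∧ τ.IsSingleton
  | .eqProp x _ y _ => (∃ τ, Γ x τ ∧ τ.IsSingleton) ∧ ∃ τ, Γ y τ ∧ τ.IsSingleton
  | .and θ₁ θ₂ => θ₁.Typed Γ ∧ θ₂.Typed Γ
  | .or θ₁ θ₂ => θ₁.Typed Γ ∧ θ₂.Typed Γ
  | .not θ => θ.Typed Γ

/-- The typing judgement `π ⊢ z : τ`; each disjunct is one typing rule. -/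
def Pattern.HasType : Pattern L K C → Var → Ty → Prop
  | .node d, z, τ => d.var = some z ∧ τ = .node
  | .edge _ d, z, τ => d.var = some z ∧ τ = .edge
  | .union π₁ π₂, z, τ =>
      (π₁.HasType z τ ∧ π₂.HasType z τ) ∨
      (∃ σ, τ = .maybe σ ∧ π₁.HasType z σ ∧ π₂.HasType z (.maybe σ)) ∨
      (∃ σ, τ = .maybe σ ∧ π₁.HasType z (.maybe σ) ∧ π₂.HasType z σ) ∨
      (∃ σ, τ = σ.opt ∧ π₁.HasType z σ ∧ z ∉ π₂.vars) ∨
      (∃ σ, τ = σ.opt ∧ π₂.HasType z σ ∧ z ∉ π₁.vars)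
  | .concat π₁ π₂, z, τ =>
      (π₁.HasType z τ ∧ π₂.HasType z τ ∧ τ.IsSingleton) ∨
      (π₁.HasType z τ ∧ z ∉ π₂.vars) ∨
      (π₂.HasType z τ ∧ z ∉ π₁.vars)
  | .cond π θ, z, τ => θ.Typed π.HasType ∧ π.HasType z τ
  | .rep π _ _ _, z, τ => ∃ σ, τ = .group σ ∧ π.HasType z σ

/-- The typing judgement `Q ⊢ z : τ`. -/
def Query.HasType : Query L K C → Var → Ty → Prop
  | .pat _ π, z, τ => π.HasType z τ
  | .named x _ π, z, τ =>
      (z = x ∧ τ = .path ∧ x ∉ π.vars) ∨ (z ≠ x ∧ π.HasType z τ)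
  | .join Q₁ Q₂, z, τ =>
      (Q₁.HasType z τ ∧ Q₂.HasType z τ ∧ τ.IsSingleton) ∨
      (Q₁.HasType z τ ∧ z ∉ Q₂.vars) ∨
      (Q₂.HasType z τ ∧ z ∉ Q₁.vars)

/-- Every variable used in the query can be typed. -/
def Query.WellTyped (Q : Query L K C) : Prop := ∀ z ∈ Q.vars, ∃ τ, Q.HasType z τ

end Syntactic

/-! ### Values and assignments -/

/-- The values: nodes, edges, paths, the special value `Nothing`, and the composite values
`list((p₁, v₁), …, (pₙ, vₙ))`. -/
inductive Value (N Ed Eu : Type*) where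
  | node (u : N)
  | edge (e : Ed ⊕ Eu)
  | path (p : GPath N Ed Eu)
  | nothing
  | list (l : List (GPath N Ed Eu × Value N Ed Eu))

/-- Partial functions from variables to values. -/
abbrev Assignment (N Ed Eu : Type*) := Var → Option (Value N Ed Eu)

namespace Assignment
variable {N Ed Eu : Type*}

/-- The assignment that binds no variables. -/
def empty : Assignment N Ed Eu := fun _ => none

/-- The assignment with domain `D` and constant value `v`. -/
def const (D : Finset Var) (v : Value N Ed Eu) : Assignment N Ed Eu :=
  fun x => if x ∈ D then some v else none

/-- `{x ↦ v}` if `x` is present, and the empty assignment otherwise. -/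
def bind (x : Option Var) (v : Value N Ed Eu) : Assignment N Ed Eu := const x.toFinset v

/-- The two assignments agree where both are defined. -/
def Unify (μ μ' : Assignment N Ed Eu) : Prop :=
  ∀ x v v', μ x = some v → μ' x = some v' → v = v'

/-- `μ ∪ μ'`. -/
def union (μ μ' : Assignment N Ed Eu) : Assignment N Ed Eu := fun x => (μ x).or (μ' x)

end Assignment

/-- An answer to a pattern: a path together with an assignment. -/
abbrev Match (N Ed Eu : Type*) := GPath N Ed Eu × Assignment N Ed Eu

/-- A nonempty list of matches. -/
structure Block (N Ed Eu : Type*) where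
  head : Match N Ed Eu
  tail : List (Match N Ed Eu)

namespace Block
variable {N Ed Eu : Type*}

def toList (b : Block N Ed Eu) : List (Match N Ed Eu) := b.head :: b.tail

/-- The concatenation of all paths in the block. -/
def path (b : Block N Ed Eu) : GPath N Ed Eu :=
  b.tail.foldl (fun p i => p.append i.1) b.head.1

/-- The union of all assignments in the block. -/
def asg (b : Block N Ed Eu) : Assignment N Ed Eu :=
  b.tail.foldl (fun μ i => μ.union i.2) b.head.2

/-- All paths in the block have length zero. -/
def Edgeless (b : Block N Ed Eu) : Prop := ∀ i ∈ b.toList, i.1.len = 0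

end Block

/-! ### Semantics -/

section Semantics
variable {N Ed Eu L K C : Type*}

/-- `μ` is the (defined) value of `collect` on the list `is`, whose members are matches with
assignments of domain `D`.  The list is cut into blocks: a block is either a single match with a
path of positive length or a maximal run of matches with edgeless paths, and the assignments in each
block have to unify pairwise.  (As all these assignments have domain `D`, the default in `getD`
plays no role.) -/
def IsCollect (D : Finset Var) (is : List (Match N Ed Eu)) (μ : Assignment N Ed Eu) : Prop :=
  ∃ bs : List (Block N Ed Eu),
    bs.flatMap Block.toList = is ∧
    (∀ b ∈ bs, (b.head.1.len ≠ 0 ∧ b.tail = []) ∨ b.Edgeless) ∧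
    bs.IsChain (fun b b' => ¬ (b.Edgeless ∧ b'.Edgeless)) ∧
    (∀ b ∈ bs, b.toList.Pairwise fun i j => i.2.Unify j.2) ∧
    ∀ x, μ x =
      if x ∈ D then some (.list (bs.map fun b => (b.path, (b.asg x).getD .nothing))) else none

/-- The `n`-th power of a set `S` of matches with assignments of domain `D`. -/
def power (D : Finset Var) (S : Set (Match N Ed Eu)) : ℕ → Set (Match N Ed Eu)
  | 0 => {m | ∃ u, m = (GPath.single u, Assignment.const D (.list []))}
  | n + 1 => {m | ∃ b : Block N Ed Eu,
      b.toList.length = n + 1 ∧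
      (∀ i ∈ b.toList, i ∈ S) ∧
      b.toList.IsChain (fun i j => i.1.Concatenates j.1) ∧
      m.1 = b.path ∧
      IsCollect D b.toList m.2}

/-- The value of key `a` at the node or edge bound by `μ` to `x`. -/
def propAt (G : PropertyGraph N Ed Eu L K C) (μ : Assignment N Ed Eu) (x : Var) (a : K) :
    Option C :=
  match μ x with
  | some (.node u) => G.prop (.inl u) a
  | some (.edge e) => G.prop (.inr e) a
  | _ => none

/-- `μ ⊨ θ`. -/
def Condition.Sat (G : PropertyGraph N Ed Eu L K C) (μ : Assignment N Ed Eu) :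
    Condition K C → Prop
  | .eqConst x a c => propAt G μ x a = some c
  | .eqProp x a y b => ∃ c, propAt G μ x a = some c ∧ propAt G μ y b = some c
  | .and θ₁ θ₂ => θ₁.Sat G μ ∧ θ₂.Sat G μ
  | .or θ₁ θ₂ => θ₁.Sat G μ ∨ θ₂.Sat G μ
  | .not θ => ¬ θ.Sat G μ

/-- `e` can be traversed from `u` to `v` in the given direction. -/
def Traverses (G : PropertyGraph N Ed Eu L K C) : Direction → N → Ed ⊕ Eu → N → Prop
  | .forward, u, .inl e, v => G.src e = u ∧ G.tgt e = v
  | .backward, u, .inl e, v => G.src e = v ∧ G.tgt e = u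
  | .undirected, u, .inr e, v => G.endpoints e = s(u, v)
  | _, _, _, _ => False

/-- The semantics of a pattern.  For the well-typed expressions, to which it is applied, the domain
of the schema of a pattern is the set of its variables. -/
def Pattern.sem (G : PropertyGraph N Ed Eu L K C) : Pattern L K C → Set (Match N Ed Eu)
  | .node d => {m | ∃ u, (∀ l ∈ d.label, l ∈ G.label (.inl u)) ∧
      m = (GPath.single u, Assignment.bind d.var (.node u))}
  | .edge dir d => {m | ∃ u e v, Traverses G dir u e v ∧
      (∀ l ∈ d.label, l ∈ G.label (.inr e)) ∧
      m = (GPath.edge u e v, Assignment.bind d.var (.edge e))}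
  | .union π₁ π₂ => {m | ∃ p μ, ((p, μ) ∈ π₁.sem G ∨ (p, μ) ∈ π₂.sem G) ∧
      m = (p, μ.union (Assignment.const (π₁.vars ∪ π₂.vars) .nothing))}
  | .concat π₁ π₂ => {m | ∃ p₁ μ₁ p₂ μ₂, (p₁, μ₁) ∈ π₁.sem G ∧ (p₂, μ₂) ∈ π₂.sem G ∧
      p₁.Concatenates p₂ ∧ μ₁.Unify μ₂ ∧ m = (p₁.append p₂, μ₁.union μ₂)}
  | .cond π θ => {m | m ∈ π.sem G ∧ θ.Sat G m.2}
  | .rep π n m _ => {a | ∃ i : ℕ, n ≤ i ∧ (i : ℕ∞) ≤ m ∧ a ∈ power π.vars (π.sem G) i}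

/-- The matches whose path is a shortest one among those with the same endpoints. -/
def shortestOf (S : Set (Match N Ed Eu)) : Set (Match N Ed Eu) :=
  {m | m ∈ S ∧ ∀ m' ∈ S, m'.1.src = m.1.src → m'.1.tgt = m.1.tgt → m.1.len ≤ m'.1.len}

/-- The matches whose path repeats no node. -/
def simpleOf (S : Set (Match N Ed Eu)) : Set (Match N Ed Eu) := {m | m ∈ S ∧ m.1.nodes.Nodup}

/-- The matches whose path repeats no edge. -/
def trailOf (S : Set (Match N Ed Eu)) : Set (Match N Ed Eu) := {m | m ∈ S ∧ m.1.edges.Nodup}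

def Restrictor.apply : Restrictor → Set (Match N Ed Eu) → Set (Match N Ed Eu)
  | .simple, S => simpleOf S
  | .trail, S => trailOf S
  | .shortest, S => shortestOf S
  | .shortestSimple, S => shortestOf (simpleOf S)
  | .shortestTrail, S => shortestOf (trailOf S)

/-- The semantics of a query: tuples of paths with an assignment. -/
def Query.sem (G : PropertyGraph N Ed Eu L K C) :
    Query L K C → Set (List (GPath N Ed Eu) × Assignment N Ed Eu)
  | .pat ρ π => {a | ∃ p μ, (p, μ) ∈ ρ.apply (π.sem G) ∧ a = ([p], μ)}
  | .named x ρ π => {a | ∃ p μ, (p, μ) ∈ ρ.apply (π.sem G) ∧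
      a = ([p], μ.union (Assignment.bind (some x) (.path p)))}
  | .join Q₁ Q₂ => {a | ∃ ps₁ μ₁ ps₂ μ₂, (ps₁, μ₁) ∈ Q₁.sem G ∧ (ps₂, μ₂) ∈ Q₂.sem G ∧
      μ₁.Unify μ₂ ∧ a = (ps₁ ++ ps₂, μ₁.union μ₂)}

end Semantics

/-- A GPC+ query of arity `n`: the rules `Ans(x̄) :- Q` for `Q` in a nonempty finite list of
(well-typed) queries. -/
structure GPCPlus (L K C : Type*) (n : ℕ) where
  head : Fin n → Var
  bodies : List (Query L K C)
  nonempty : bodies ≠ []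
  wellTyped : ∀ Q ∈ bodies, Q.WellTyped
  head_mem : ∀ Q ∈ bodies, ∀ i, head i ∈ Q.vars

/-- The union of the projections of the answers to the bodies. -/
def GPCPlus.answers {N Ed Eu L K C : Type*} {n : ℕ} (q : GPCPlus L K C n)
    (G : PropertyGraph N Ed Eu L K C) : Set (Fin n → Value N Ed Eu) :=
  {t | ∃ Q ∈ q.bodies, ∃ ps μ, (ps, μ) ∈ Q.sem G ∧ ∀ i, μ (q.head i) = some (t i)}

/-- Tuples of nodes, seen as tuples of values. -/
def nodeTuples {N : Type*} (Ed Eu : Type*) {n : ℕ} (S : Set (Fin n → N)) :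
    Set (Fin n → Value N Ed Eu) :=
  (fun t i => Value.node (t i)) '' S

/-! ### Unions of conjunctive two-way regular path queries -/

/-- The alphabet of edge labels `a` and inverse edge labels `a⁻`. -/
inductive Letter (L : Type*) where
  | fwd (a : L)
  | bwd (a : L)

section Languages
variable {N Ed Eu L K C : Type*}

/-- There is a directed edge from `u` to `v` with label `a`. -/
def EdgeRel (G : PropertyGraph N Ed Eu L K C) (a : L) (u v : N) : Prop :=
  ∃ e : Ed, G.src e = u ∧ G.tgt e = v ∧ a ∈ G.label (.inr (.inl e))

def Letter.Rel (G : PropertyGraph N Ed Eu L K C) : Letter L → N → N → Prop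
  | .fwd a, u, v => EdgeRel G a u v
  | .bwd a, u, v => EdgeRel G a v u

/-- There is a two-way path from `u` to `v` spelling the given word. -/
def WordRel (G : PropertyGraph N Ed Eu L K C) : List (Letter L) → N → N → Prop
  | [], u, v => u = v
  | s :: w, u, v => ∃ z, s.Rel G u z ∧ WordRel G w z v

/-- The answers to a two-way regular path query. -/
def RPQRel (G : PropertyGraph N Ed Eu L K C) (r : RegularExpression (Letter L)) (u v : N) : Prop :=
  ∃ w ∈ r.matches', WordRel G w u v

end Languages

/-- The atom `r(x, y)` for a two-way regular path query `r`. -/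
structure RPQAtom (L : Type*) where
  x : Var
  r : RegularExpression (Letter L)
  y : Var

/-- A conjunctive two-way regular path query `Ans(x̄) :- r₁(y₁, z₁), …, rₘ(yₘ, zₘ)`, `m ≥ 1`. -/
structure C2RPQ (L : Type*) (n : ℕ) where
  head : Fin n → Var
  body : List (RPQAtom L)
  nonempty : body ≠ []
  safe : ∀ i, ∃ a ∈ body, head i = a.x ∨ head i = a.y

/-- A finite union of conjunctive two-way regular path queries of the same arity. -/
abbrev UC2RPQ (L : Type*) (n : ℕ) := List (C2RPQ L n)

section Languages
variable {N Ed Eu L K C : Type*}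

def C2RPQ.answers {n : ℕ} (q : C2RPQ L n) (G : PropertyGraph N Ed Eu L K C) : Set (Fin n → N) :=
  {t | ∃ ν : Var → N, (∀ a ∈ q.body, RPQRel G a.r (ν a.x) (ν a.y)) ∧ ∀ i, t i = ν (q.head i)}

def UC2RPQ.answers {n : ℕ} (q : UC2RPQ L n) (G : PropertyGraph N Ed Eu L K C) : Set (Fin n → N) :=
  {t | ∃ c ∈ q, t ∈ C2RPQ.answers c G}

end Languages

/-! ### Nested regular expressions -/

inductive NRE (L : Type*) where
  | eps
  | letter (s : Letter L)
  | seq (e₁ e₂ : NRE L)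
  | alt (e₁ e₂ : NRE L)
  | star (e : NRE L)
  /-- The nesting operator `[e]`. -/
  | test (e : NRE L)

section Languages
variable {N Ed Eu L K C : Type*}

def NRE.Rel (G : PropertyGraph N Ed Eu L K C) : NRE L → N → N → Prop
  | .eps, u, v => u = v
  | .letter s, u, v => s.Rel G u v
  | .seq e₁ e₂, u, v => ∃ z, e₁.Rel G u z ∧ e₂.Rel G z v
  | .alt e₁ e₂, u, v => e₁.Rel G u v ∨ e₂.Rel G u v
  | .star e, u, v => Relation.ReflTransGen (e.Rel G) u v
  | .test e, u, v => u = v ∧ ∃ z, e.Rel G u z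

def NRE.answers (e : NRE L) (G : PropertyGraph N Ed Eu L K C) : Set (Fin 2 → N) :=
  {t | e.Rel G (t 0) (t 1)}

end Languages

/-! ### Regular queries -/

/-- The atoms in rule bodies; user-defined predicates are named by natural numbers. -/
inductive Atom (L : Type*) where
  /-- `A(x)` for a node label `A` -/
  | nodeLabel (A : L) (x : Var)
  /-- `a(x, y)` for an edge label `a` -/
  | edgeLabel (a : L) (x y : Var)
  /-- `P(x₁, …, xₖ)` for a user-defined predicate `P` -/
  | pred (P : ℕ) (args : List Var)
  /-- the transitive atom `a⁺(x, y)` -/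
  | edgePlus (a : L) (x y : Var)
  /-- the transitive atom `P⁺(x, y)` -/
  | predPlus (P : ℕ) (x y : Var)

/-- The variables of an atom. -/
def Atom.vars {L : Type*} : Atom L → List Var
  | .nodeLabel _ x => [x]
  | .edgeLabel _ x y => [x, y]
  | .pred _ args => args
  | .edgePlus _ x y => [x, y]
  | .predPlus _ x y => [x, y]

/-- The user-defined predicate `P` occurs in the atom. -/
def Atom.Uses {L : Type*} (P : ℕ) : Atom L → Prop
  | .pred Q _ => Q = P
  | .predPlus Q _ _ => Q = P
  | _ => False

/-- The atom uses predicates according to their arities. -/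
def Atom.RespectsArity {L : Type*} (arity : ℕ → ℕ) : Atom L → Prop
  | .pred P args => args.length = arity P
  | .predPlus P _ _ => arity P = 2
  | _ => True

/-- A safe rule `P(x₁, …, xₖ) :- R₁, …, Rₘ` with `m ≥ 1`. -/
structure Rule (L : Type*) where
  headPred : ℕ
  headArgs : List Var
  body : List (Atom L)
  nonempty : body ≠ []
  safe : ∀ x ∈ headArgs, ∃ a ∈ body, x ∈ a.vars

/-- A regular query of arity `n`: a nonrecursive Datalog program with transitive atoms and a
distinguished answer predicate of arity `n`. -/
structure RegularQuery (L : Type*) (n : ℕ) where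
  arity : ℕ → ℕ
  rules : List (Rule L)
  ans : ℕ
  arity_ans : arity ans = n
  arity_head : ∀ r ∈ rules, r.headArgs.length = arity r.headPred
  arity_body : ∀ r ∈ rules, ∀ a ∈ r.body, a.RespectsArity arity
  nonrecursive : ∀ P, ¬ Relation.TransGen
    (fun Q R => ∃ r ∈ rules, r.headPred = R ∧ ∃ a ∈ r.body, a.Uses Q) P P

section Languages
variable {N Ed Eu L K C : Type*}

/-- The atom holds in `G` when user-defined predicates are interpreted by `I` and variables by
`ν`. -/
def Atom.Holds (G : PropertyGraph N Ed Eu L K C) (I : ℕ → List N → Prop) (ν : Var → N) :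
    Atom L → Prop
  | .nodeLabel A x => A ∈ G.label (.inl (ν x))
  | .edgeLabel a x y => EdgeRel G a (ν x) (ν y)
  | .pred P args => I P (args.map ν)
  | .edgePlus a x y => Relation.TransGen (EdgeRel G a) (ν x) (ν y)
  | .predPlus P x y => Relation.TransGen (fun u v => I P [u, v]) (ν x) (ν y)

/-- All rules of the program are satisfied in the interpretation `I`. -/
def RegularQuery.IsModel {n : ℕ} (q : RegularQuery L n) (G : PropertyGraph N Ed Eu L K C)
    (I : ℕ → List N → Prop) : Prop :=
  ∀ r ∈ q.rules, ∀ ν : Var → N, (∀ a ∈ r.body, a.Holds G I ν) → I r.headPred (r.headArgs.map ν)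

/-- The answer relation in the least model of the program. -/
def RegularQuery.answers {n : ℕ} (q : RegularQuery L n) (G : PropertyGraph N Ed Eu L K C) :
    Set (Fin n → N) :=
  {t | ∀ I, q.IsModel G I → I q.ans (List.ofFn t)}

end Languages

end GPC

/-! All three languages reduce to one normal form: a finite union of conjunctive queries whose atoms
are binary relations definable by patterns (`TupleDefinable`). Such a union becomes a GPC+ query
with one rule per disjunct and one pattern `(x) π (y)` per atom. The restrictor `shortest` loses no
answers there, because the two node variables are determined by the endpoints of the path
(`PatternDefinable.shortest`).

The admissible atoms are the relations that are, together with their converses, endpoint relations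
of patterns (`BiDefinable`). They are closed under composition, union and transitive closure. For
the last, edgeless matches are dropped from a chain, since merging a run of them might fail
(`endpointRel_power_iff`). Having the converse allows a pattern to walk back along an atom. Hence a
connected conjunctive query is matched by a single walk through all its atoms, with repeated node
variables acting as joins, and it defines another admissible atom (`RelAtom.biDefinable_of_conn`).
Typing and unification cause no trouble as long as variables other than the intended node variables
can be chosen outside any given finite set.

The crux is that binary unions of conjunctive queries are closed under transitive closure
(`RelDefinable.transGen`). If the two distinguished variables of a disjunct are connected, the
disjunct is an admissible relation guarded by a Boolean query; otherwise it is a product `φ(u) ∧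
ψ(v)`. A guard is constant on a graph, so it is settled by a case distinction. A product step is
needed at most once on a path, as everything between its first and last use can be skipped.
Disjuncts are added one at a time; the induction hypothesis (`PlusDefinable`) carries an extra
admissible relation `R` that absorbs the guarded disjuncts.

Regular expressions and nested regular expressions are then handled by structural induction, and
regular queries by induction along the dependency order of their predicates. -/

namespace GPC

universe a b c d e f

/-! ### Relations given uniformly on all graphs -/

section Families

set_option linter.checkUnivs false

/-- A binary relation on nodes, given uniformly on all property graphs. -/
abbrev NodeRel (L : Type d) (K : Type e) (C : Type f) :=
  ∀ ⦃N : Type a⦄ ⦃Ed : Type b⦄ ⦃Eu : Type c⦄, PropertyGraph N Ed Eu L K C → N → N → Prop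

/-- A property of tuples of nodes indexed by `α`, given uniformly on all property graphs. -/
abbrev TupleRel (L : Type d) (K : Type e) (C : Type f) (α : Type) :=
  ∀ ⦃N : Type a⦄ ⦃Ed : Type b⦄ ⦃Eu : Type c⦄, PropertyGraph N Ed Eu L K C → (α → N) → Prop

/-- A relation between the two endpoints of a path and a valuation of the variables by nodes. -/
abbrev PathRel (L : Type d) (K : Type e) (C : Type f) :=
  ∀ ⦃N : Type a⦄ ⦃Ed : Type b⦄ ⦃Eu : Type c⦄, PropertyGraph N Ed Eu L K C → N → N →
    (Var → N) → Prop

end Families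

/-! ### Endpoints of concatenated paths -/

namespace GPath
variable {N Ed Eu : Type*}

@[simp] theorem src_append (p q : GPath N Ed Eu) : (p.append q).src = p.src := rfl

theorem tgt_append {p q : GPath N Ed Eu} (h : p.Concatenates q) :
    (p.append q).tgt = q.tgt := by
  obtain ⟨u, s⟩ := p
  obtain ⟨v, t⟩ := q
  simp only [Concatenates, tgt] at h
  subst h
  simp [append, tgt, List.getLastD_eq_getLast?]

theorem tgt_eq_src_of_len_eq_zero {p : GPath N Ed Eu} (h : p.len = 0) : p.tgt = p.src := by
  obtain ⟨u, s⟩ := p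
  obtain rfl : s = [] := List.length_eq_zero_iff.1 h
  rfl

@[simp] theorem src_single (u : N) : (single u : GPath N Ed Eu).src = u := rfl
@[simp] theorem tgt_single (u : N) : (single u : GPath N Ed Eu).tgt = u := rfl

end GPath

namespace Block
variable {N Ed Eu : Type*}

/-- `Block.path` is a left fold, so the induction needs an arbitrary accumulator `p`. All that
matters for the next concatenation is that `p` ends where the last absorbed match `i` ends. -/
theorem foldl_append_src_tgt (l : List (Match N Ed Eu)) (i : Match N Ed Eu) (p : GPath N Ed Eu)
    (hp : p.tgt = i.1.tgt) (hl : (i :: l).IsChain fun i j => i.1.Concatenates j.1) :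
    (l.foldl (fun p i => p.append i.1) p).src = p.src ∧
      (l.foldl (fun p i => p.append i.1) p).tgt = ((i :: l).getLast (by simp)).1.tgt := by
  induction l generalizing i p with
  | nil => simpa using hp
  | cons j l ih =>
    rw [List.isChain_cons_cons] at hl
    have h : p.Concatenates j.1 := hp.trans hl.1
    simpa using ih j (p.append j.1) (GPath.tgt_append h) hl.2

theorem path_src_tgt (β : Block N Ed Eu)
    (h : β.toList.IsChain fun i j => i.1.Concatenates j.1) :
    β.path.src = β.head.1.src ∧ β.path.tgt = (β.toList.getLast (by simp [toList])).1.tgt :=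
  foldl_append_src_tgt β.tail β.head β.head.1 rfl h

end Block

/-! ### Endpoint relations of powers, and domains of assignments -/

section Sem
variable {N Ed Eu L K C : Type*}

/-- The binary relation between the endpoints of the paths in a set of matches. -/
def endpointRel (S : Set (Match N Ed Eu)) (u v : N) : Prop :=
  ∃ m ∈ S, m.1.src = u ∧ m.1.tgt = v

theorem transGen_endpointRel_of_isChain {S : Set (Match N Ed Eu)} (l : List (Match N Ed Eu))
    (i : Match N Ed Eu) (hS : ∀ j ∈ i :: l, j ∈ S)
    (hl : (i :: l).IsChain fun i j => i.1.Concatenates j.1) :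
    Relation.TransGen (endpointRel S) i.1.src ((i :: l).getLast (by simp)).1.tgt := by
  induction l generalizing i with
  | nil => exact .single ⟨i, hS i (by simp), rfl, rfl⟩
  | cons j l ih =>
    rw [List.isChain_cons_cons] at hl
    have := ih j (fun k hk => hS k (List.mem_cons_of_mem _ hk)) hl.2
    rw [List.getLast_cons (by simp)]
    exact .head ⟨i, hS i (by simp), rfl, hl.1⟩ this

theorem exists_block_of_transGen {S : Set (Match N Ed Eu)} {u v : N}
    (h : Relation.TransGen (endpointRel S) u v) :
    ∃ β : Block N Ed Eu, (∀ i ∈ β.toList, i ∈ S) ∧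
      (β.toList.IsChain fun i j => i.1.Concatenates j.1) ∧
      β.head.1.src = u ∧ (β.toList.getLast (by simp [Block.toList])).1.tgt = v := by
  induction h using Relation.TransGen.head_induction_on with
  | single h =>
    obtain ⟨m, hm, h1, h2⟩ := h
    exact ⟨⟨m, []⟩, by simpa [Block.toList] using hm, by simp [Block.toList], h1, h2⟩
  | head h _ ih =>
    obtain ⟨m, hm, h1, h2⟩ := h
    obtain ⟨⟨i, l⟩, hS, hc, hs, ht⟩ := ih
    refine ⟨⟨m, i :: l⟩, ?_, ?_, h1, ?_⟩
    · intro j hj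
      rcases List.mem_cons.1 hj with rfl | hj
      exacts [hm, hS j hj]
    · exact List.isChain_cons_cons.2 ⟨h2.trans hs.symm, hc⟩
    · simpa [Block.toList] using ht

/-- An edgeless match is a loop at a node, so it can be deleted from a chain. Either only matches of
positive length remain, or nothing remains and one edgeless match alone joins `u` to `v`. -/
theorem transGen_endpointRel_cases {S : Set (Match N Ed Eu)} {u v : N}
    (h : Relation.TransGen (endpointRel S) u v) :
    Relation.TransGen (endpointRel {m | m ∈ S ∧ m.1.len ≠ 0}) u v ∨ endpointRel S u v := by
  induction h using Relation.TransGen.head_induction_on with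
  | single h => exact .inr h
  | head h _ ih =>
    obtain ⟨m, hm, rfl, rfl⟩ := h
    by_cases h0 : m.1.len = 0
    · rwa [GPath.tgt_eq_src_of_len_eq_zero h0] at ih
    · rcases ih with ih | ⟨m', hm', h1, h2⟩
      · exact .inl (.head ⟨m, ⟨hm, h0⟩, rfl, rfl⟩ ih)
      · by_cases h0' : m'.1.len = 0
        · rw [GPath.tgt_eq_src_of_len_eq_zero h0'] at h2
          exact .inr ⟨m, hm, rfl, h1.symm.trans h2⟩
        · exact .inl (.head ⟨m, ⟨hm, h0⟩, rfl, rfl⟩ (.single ⟨m', ⟨hm', h0'⟩, h1, h2⟩))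

/-- Under the hypothesis every match can form a block of its own: no two adjacent blocks are
edgeless, and unification inside a block is vacuous. -/
theorem exists_isCollect (D : Finset Var) (β : Block N Ed Eu)
    (h : β.tail = [] ∨ ∀ i ∈ β.toList, i.1.len ≠ 0) : ∃ μ, IsCollect D β.toList μ := by
  refine ⟨_, β.toList.map fun i => ⟨i, []⟩, ?_, ?_, ?_, ?_, fun x => rfl⟩
  · simp [List.flatMap_map, Block.toList]
  · intro γ hγ
    obtain ⟨i, hi, rfl⟩ := List.mem_map.1 hγ
    by_cases h0 : i.1.len = 0
    · right
      simpa [Block.Edgeless, Block.toList] using h0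
    · exact .inl ⟨h0, rfl⟩
  · rcases h with h | h
    · simp [Block.toList, h]
    · rw [List.isChain_map]
      refine List.Pairwise.isChain (List.pairwise_of_forall_mem_list fun i hi j _ hij => h i hi ?_)
      exact hij.1 i (by simp [Block.toList])
  · intro γ hγ
    obtain ⟨i, hi, rfl⟩ := List.mem_map.1 hγ
    simp [Block.toList]

/-- Deleting edgeless matches makes `collect` defined, so its unification condition is invisible at
the level of endpoints. The deletion changes the number of factors, which is why only the union over
all positive exponents is described. -/
theorem endpointRel_power_iff (D : Finset Var) (S : Set (Match N Ed Eu)) (u v : N) :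
    (∃ i, 1 ≤ i ∧ endpointRel (power D S i) u v) ↔ Relation.TransGen (endpointRel S) u v := by
  constructor
  · rintro ⟨i, hi, ⟨m, hm, rfl, rfl⟩⟩
    obtain ⟨i, rfl⟩ : ∃ j, i = j + 1 := ⟨i - 1, by omega⟩
    obtain ⟨β, -, hS, hc, hp, -⟩ := hm
    rw [hp, (β.path_src_tgt hc).1, (β.path_src_tgt hc).2]
    exact transGen_endpointRel_of_isChain β.tail β.head hS hc
  · intro h
    suffices ∃ β : Block N Ed Eu, (∀ i ∈ β.toList, i ∈ S) ∧
        (β.toList.IsChain fun i j => i.1.Concatenates j.1) ∧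
        β.head.1.src = u ∧ (β.toList.getLast (by simp [Block.toList])).1.tgt = v ∧
        (β.tail = [] ∨ ∀ i ∈ β.toList, i.1.len ≠ 0) by
      obtain ⟨β, hS, hc, hs, ht, h0⟩ := this
      obtain ⟨μ, hμ⟩ := exists_isCollect D β h0
      refine ⟨β.tail.length + 1, by omega, (β.path, μ), ⟨β, rfl, hS, hc, rfl, hμ⟩, ?_, ?_⟩
      · rw [(β.path_src_tgt hc).1, hs]
      · rw [(β.path_src_tgt hc).2, ht]
    rcases transGen_endpointRel_cases h with h | ⟨m, hm, h1, h2⟩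
    · obtain ⟨β, hS, hc, hs, ht⟩ := exists_block_of_transGen h
      exact ⟨β, fun i hi => (hS i hi).1, hc, hs, ht, .inr fun i hi => (hS i hi).2⟩
    · exact ⟨⟨m, []⟩, by simpa [Block.toList] using hm, by simp [Block.toList], h1, h2, .inl rfl⟩

theorem Assignment.const_eq_some {D : Finset Var} {v w : Value N Ed Eu} {x : Var}
    (h : Assignment.const D v x = some w) : x ∈ D ∧ w = v := by
  unfold Assignment.const at h
  split at h
  · exact ⟨‹_›, by simpa using h.symm⟩
  · cases h

theorem Assignment.union_eq_some {μ μ' : Assignment N Ed Eu} {v : Value N Ed Eu} {x : Var}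
    (h : μ.union μ' x = some v) : μ x = some v ∨ μ' x = some v := by
  unfold Assignment.union at h
  cases hx : μ x <;> simp_all

theorem mem_of_mem_power {D : Finset Var} {S : Set (Match N Ed Eu)} {i : ℕ} {m : Match N Ed Eu}
    (hm : m ∈ power D S i) {x : Var} {v : Value N Ed Eu} (h : m.2 x = some v) : x ∈ D := by
  cases i with
  | zero =>
    obtain ⟨u, rfl⟩ := hm
    exact (Assignment.const_eq_some h).1
  | succ i =>
    obtain ⟨β, -, -, -, -, bs, -, -, -, -, hμ⟩ := hm
    rw [hμ] at h
    by_contra hx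
    simp [hx] at h

/-- This reduces the unification of two matches to the variables shared by their patterns. -/
theorem Pattern.mem_vars_of_mem_sem {G : PropertyGraph N Ed Eu L K C} {π : Pattern L K C}
    {m : Match N Ed Eu} (hm : m ∈ π.sem G) {x : Var} {v : Value N Ed Eu} (h : m.2 x = some v) :
    x ∈ π.vars := by
  induction π generalizing m v with
  | node d =>
    obtain ⟨u, -, rfl⟩ := hm
    exact (Assignment.const_eq_some h).1
  | edge dir d =>
    obtain ⟨u, _, _, -, -, rfl⟩ := hm
    exact (Assignment.const_eq_some h).1
  | union π₁ π₂ ih₁ ih₂ =>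
    obtain ⟨p, μ, hp, rfl⟩ := hm
    rcases Assignment.union_eq_some h with h | h
    · rcases hp with hp | hp
      · exact Finset.mem_union_left _ (ih₁ hp h)
      · exact Finset.mem_union_right _ (ih₂ hp h)
    · exact (Assignment.const_eq_some h).1
  | concat π₁ π₂ ih₁ ih₂ =>
    obtain ⟨p₁, μ₁, p₂, μ₂, h₁, h₂, -, -, rfl⟩ := hm
    rcases Assignment.union_eq_some h with h | h
    · exact Finset.mem_union_left _ (ih₁ h₁ h)
    · exact Finset.mem_union_right _ (ih₂ h₂ h)
  | cond π θ ih => exact Finset.mem_union_left _ (ih hm.1 h)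
  | rep π n k hnk ih =>
    obtain ⟨i, -, -, hi⟩ := hm
    exact mem_of_mem_power hi h

theorem Query.mem_vars_of_mem_sem {G : PropertyGraph N Ed Eu L K C} {Q : Query L K C}
    {m : List (GPath N Ed Eu) × Assignment N Ed Eu} (hm : m ∈ Q.sem G) {x : Var}
    {v : Value N Ed Eu} (h : m.2 x = some v) : x ∈ Q.vars := by
  have key : ∀ (ρ : Restrictor) (S : Set (Match N Ed Eu)), ρ.apply S ⊆ S := by
    rintro (_ | _ | _ | _ | _) S m hm
    exacts [hm.1, hm.1, hm.1, hm.1.1, hm.1.1]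
  induction Q generalizing m v with
  | pat ρ π =>
    obtain ⟨p, μ, hp, rfl⟩ := hm
    exact Pattern.mem_vars_of_mem_sem (key _ _ hp) h
  | named y ρ π =>
    obtain ⟨p, μ, hp, rfl⟩ := hm
    rcases Assignment.union_eq_some h with h | h
    · exact Finset.mem_union_right _ (Pattern.mem_vars_of_mem_sem (key _ _ hp) h)
    · refine Finset.mem_union_left _ ?_
      simpa using (Assignment.const_eq_some h).1
  | join Q₁ Q₂ ih₁ ih₂ =>
    obtain ⟨p₁, μ₁, p₂, μ₂, h₁, h₂, -, rfl⟩ := hm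
    rcases Assignment.union_eq_some h with h | h
    · exact Finset.mem_union_left _ (ih₁ h₁ h)
    · exact Finset.mem_union_right _ (ih₂ h₂ h)

end Sem

/-! ### Relations defined by patterns -/

section Definability
variable {L : Type d} {K : Type e} {C : Type f}


/-- The well-typed pattern `π` has the node variables `V`, and its matches are described, up to
the values of the remaining variables, by `R`. -/
structure Pattern.Defines (π : Pattern L K C) (V : Finset Var) (R : PathRel.{a, b, c, d, e, f} L K C) : Prop where
  subset : V ⊆ π.vars
  node : ∀ z ∈ V, π.HasType z .node
  typed : ∀ z ∈ π.vars, ∃ τ, π.HasType z τ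
  bound : ∀ ⦃N : Type a⦄ ⦃Ed : Type b⦄ ⦃Eu : Type c⦄ (G : PropertyGraph N Ed Eu L K C), ∀ m ∈ π.sem G, ∀ x ∈ V,
    ∃ u, m.2 x = some (.node u)
  sound : ∀ ⦃N : Type a⦄ ⦃Ed : Type b⦄ ⦃Eu : Type c⦄ (G : PropertyGraph N Ed Eu L K C), ∀ m ∈ π.sem G, ∀ ν : Var → N,
    (∀ x ∈ V, m.2 x = some (.node (ν x))) → R G m.1.src m.1.tgt ν
  complete : ∀ ⦃N : Type a⦄ ⦃Ed : Type b⦄ ⦃Eu : Type c⦄ (G : PropertyGraph N Ed Eu L K C) (u v : N) (ν : Var → N), R G u v ν →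
    ∃ m ∈ π.sem G, m.1.src = u ∧ m.1.tgt = v ∧ ∀ x ∈ V, m.2 x = some (.node (ν x))

/-- `R` is defined by patterns with node variables `V` whose other variables are fresh. -/
def PatternDefinable (V : Finset Var) (R : PathRel.{a, b, c, d, e, f} L K C) : Prop :=
  ∀ F : Finset Var, ∃ π : Pattern L K C, π.Defines V R ∧ π.vars ∩ F ⊆ V

theorem PatternDefinable.congr {V : Finset Var} {R R' : PathRel.{a, b, c, d, e, f} L K C} (h : PatternDefinable V R)
    (hR : ∀ ⦃N : Type a⦄ ⦃Ed : Type b⦄ ⦃Eu : Type c⦄ (G : PropertyGraph N Ed Eu L K C) u v ν, R G u v ν ↔ R' G u v ν) :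
    PatternDefinable V R' := by
  obtain rfl : R = R' := by
    funext N Ed Eu G u v ν
    exact propext (hR G u v ν)
  exact h

theorem patternDefinable_node (x : Var) :
    PatternDefinable {x} (fun _ _ _ _ u v ν => ν x = u ∧ ν x = v : PathRel.{a, b, c, d, e, f} L K C) := by
  refine fun F => ⟨.node ⟨some x, none⟩, ⟨?_, ?_, ?_, ?_, ?_, ?_⟩, ?_⟩
  · simp [Pattern.vars]
  · simp [Pattern.HasType]
  · simp [Pattern.vars, Pattern.HasType]
  · rintro N Ed Eu G _ ⟨u, -, rfl⟩ z hz
    exact ⟨u, by simp_all [Assignment.bind, Assignment.const]⟩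
  · rintro N Ed Eu G _ ⟨u, -, rfl⟩ ν hν
    have := hν x (by simp)
    simp [Assignment.bind, Assignment.const] at this
    simp [this]
  · rintro N Ed Eu G u v ν ⟨rfl, rfl⟩
    exact ⟨_, ⟨ν x, by simp, rfl⟩, rfl, rfl, by simp [Assignment.bind, Assignment.const]⟩
  · exact Finset.inter_subset_left

theorem patternDefinable_id :
    PatternDefinable ∅ (fun _ _ _ _ u v _ => u = v : PathRel.{a, b, c, d, e, f} L K C) := by
  refine fun F => ⟨.node ⟨none, none⟩, ⟨?_, ?_, ?_, ?_, ?_, ?_⟩, ?_⟩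
  · simp
  · simp
  · simp [Pattern.vars]
  · simp
  · rintro N Ed Eu G _ ⟨u, -, rfl⟩ ν hν
    rfl
  · rintro N Ed Eu G u v ν rfl
    exact ⟨_, ⟨u, by simp, rfl⟩, rfl, rfl, by simp⟩
  · simp [Pattern.vars]

theorem patternDefinable_label (A : L) :
    PatternDefinable ∅ (fun _ _ _ G u v _ => u = v ∧ A ∈ G.label (.inl u) : PathRel.{a, b, c, d, e, f} L K C) := by
  refine fun F => ⟨.node ⟨none, some A⟩, ⟨?_, ?_, ?_, ?_, ?_, ?_⟩, ?_⟩
  · simp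
  · simp
  · simp [Pattern.vars]
  · simp
  · rintro N Ed Eu G _ ⟨u, hu, rfl⟩ ν hν
    exact ⟨rfl, by simpa using hu⟩
  · rintro N Ed Eu G u v ν ⟨rfl, hA⟩
    exact ⟨_, ⟨u, by simpa using hA, rfl⟩, rfl, rfl, by simp⟩
  · simp [Pattern.vars]

theorem patternDefinable_fwd (l : L) :
    PatternDefinable ∅ (fun _ _ _ G u v _ => EdgeRel G l u v : PathRel.{a, b, c, d, e, f} L K C) := by
  refine fun F => ⟨.edge .forward ⟨none, some l⟩, ⟨?_, ?_, ?_, ?_, ?_, ?_⟩, ?_⟩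
  · simp
  · simp
  · simp [Pattern.vars]
  · simp
  · rintro N Ed Eu G _ ⟨u, ε | ε, v, ht, hl, rfl⟩ ν hν
    · exact ⟨ε, ht.1, ht.2, by simpa using hl⟩
    · exact ht.elim
  · rintro N Ed Eu G u v ν ⟨ε, hs, ht, hl⟩
    exact ⟨_, ⟨u, .inl ε, v, ⟨hs, ht⟩, by simpa using hl, rfl⟩, rfl, rfl, by simp⟩
  · simp [Pattern.vars]

theorem patternDefinable_bwd (l : L) :
    PatternDefinable ∅ (fun _ _ _ G u v _ => EdgeRel G l v u : PathRel.{a, b, c, d, e, f} L K C) := by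
  refine fun F => ⟨.edge .backward ⟨none, some l⟩, ⟨?_, ?_, ?_, ?_, ?_, ?_⟩, ?_⟩
  · simp
  · simp
  · simp [Pattern.vars]
  · simp
  · rintro N Ed Eu G _ ⟨u, ε | ε, v, ht, hl, rfl⟩ ν hν
    · exact ⟨ε, ht.1, ht.2, by simpa using hl⟩
    · exact ht.elim
  · rintro N Ed Eu G u v ν ⟨ε, hs, ht, hl⟩
    exact ⟨_, ⟨u, .inl ε, v, ⟨hs, ht⟩, by simpa using hl, rfl⟩, rfl, rfl, by simp⟩
  · simp [Pattern.vars]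

theorem Assignment.union_apply_of_unify {N Ed Eu : Type*} {μ₁ μ₂ : Assignment N Ed Eu}
    (h : μ₁.Unify μ₂) {x : Var} {v : Value N Ed Eu} (hx : μ₁ x = some v ∨ μ₂ x = some v) :
    μ₁.union μ₂ x = some v := by
  unfold Assignment.union
  cases h₁ : μ₁ x with
  | none => simpa [h₁] using hx
  | some w =>
    rcases hx with hx | hx
    · simpa [h₁] using hx
    · simpa using h x w v h₁ hx

/-- By `hV` a shared variable is a node variable on both sides. This makes the concatenation
well-typed, and it makes matches obtained from the same valuation unify. -/
theorem Pattern.Defines.concat {π₁ π₂ : Pattern L K C} {V₁ V₂ : Finset Var} {R₁ R₂ : PathRel.{a, b, c, d, e, f} L K C}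
    (h₁ : π₁.Defines V₁ R₁) (h₂ : π₂.Defines V₂ R₂) (hV : π₁.vars ∩ π₂.vars ⊆ V₁ ∩ V₂) :
    (Pattern.concat π₁ π₂).Defines (V₁ ∪ V₂)
      (fun _ _ _ G u v ν => ∃ w, R₁ G u w ν ∧ R₂ G w v ν) where
  subset := Finset.union_subset_union h₁.subset h₂.subset
  node z hz := by
    have hV' : z ∈ π₁.vars → z ∈ π₂.vars → z ∈ V₁ ∧ z ∈ V₂ := fun a b =>
      Finset.mem_inter.1 (hV (Finset.mem_inter.2 ⟨a, b⟩))
    rcases Finset.mem_union.1 hz with hz | hz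
    · by_cases h : z ∈ π₂.vars
      · exact .inl ⟨h₁.node z hz, h₂.node z (hV' (h₁.subset hz) h).2, .inl rfl⟩
      · exact .inr (.inl ⟨h₁.node z hz, h⟩)
    · by_cases h : z ∈ π₁.vars
      · exact .inl ⟨h₁.node z (hV' h (h₂.subset hz)).1, h₂.node z hz, .inl rfl⟩
      · exact .inr (.inr ⟨h₂.node z hz, h⟩)
  typed z hz := by
    by_cases hz₁ : z ∈ π₁.vars
    · by_cases hz₂ : z ∈ π₂.vars
      · have := Finset.mem_inter.1 (hV (Finset.mem_inter.2 ⟨hz₁, hz₂⟩))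
        exact ⟨.node, .inl ⟨h₁.node z this.1, h₂.node z this.2, .inl rfl⟩⟩
      · obtain ⟨τ, hτ⟩ := h₁.typed z hz₁
        exact ⟨τ, .inr (.inl ⟨hτ, hz₂⟩)⟩
    · obtain ⟨τ, hτ⟩ := h₂.typed z ((Finset.mem_union.1 hz).resolve_left hz₁)
      exact ⟨τ, .inr (.inr ⟨hτ, hz₁⟩)⟩
  bound := by
    rintro N Ed Eu G _ ⟨p₁, μ₁, p₂, μ₂, hm₁, hm₂, -, hu, rfl⟩ z hz
    rcases Finset.mem_union.1 hz with hz | hz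
    · obtain ⟨u, h⟩ := h₁.bound G _ hm₁ z hz
      exact ⟨u, Assignment.union_apply_of_unify hu (.inl h)⟩
    · obtain ⟨u, h⟩ := h₂.bound G _ hm₂ z hz
      exact ⟨u, Assignment.union_apply_of_unify hu (.inr h)⟩
  sound := by
    rintro N Ed Eu G _ ⟨p₁, μ₁, p₂, μ₂, hm₁, hm₂, hc, hu, rfl⟩ ν hν
    refine ⟨p₁.tgt, h₁.sound G _ hm₁ ν fun x hx => ?_, ?_⟩
    · obtain ⟨u, h⟩ := h₁.bound G _ hm₁ x hx
      exact h.trans ((Assignment.union_apply_of_unify hu (.inl h)).symm.trans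
        (hν x (Finset.mem_union_left _ hx)))
    · have := h₂.sound G _ hm₂ ν fun x hx => by
        obtain ⟨u, h⟩ := h₂.bound G _ hm₂ x hx
        exact h.trans ((Assignment.union_apply_of_unify hu (.inr h)).symm.trans
          (hν x (Finset.mem_union_right _ hx)))
      change R₂ G p₁.tgt (p₁.append p₂).tgt ν
      rw [GPath.tgt_append hc, show p₁.tgt = p₂.src from hc]
      exact this
  complete := by
    rintro N Ed Eu G u v ν ⟨w, hR₁, hR₂⟩
    obtain ⟨⟨p₁, μ₁⟩, hm₁, hs₁, ht₁, hν₁⟩ := h₁.complete G _ _ _ hR₁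
    obtain ⟨⟨p₂, μ₂⟩, hm₂, hs₂, ht₂, hν₂⟩ := h₂.complete G _ _ _ hR₂
    have hc : p₁.Concatenates p₂ := ht₁.trans hs₂.symm
    have hu : μ₁.Unify μ₂ := by
      intro x v v' hv hv'
      have hx := Finset.mem_inter.1 (hV (Finset.mem_inter.2
        ⟨Pattern.mem_vars_of_mem_sem hm₁ hv, Pattern.mem_vars_of_mem_sem hm₂ hv'⟩))
      have e₁ := hν₁ x hx.1
      have e₂ := hν₂ x hx.2
      simp only at e₁ e₂
      rw [e₁] at hv
      rw [e₂] at hv'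
      exact (Option.some.inj hv).symm.trans (Option.some.inj hv')
    refine ⟨_, ⟨p₁, μ₁, p₂, μ₂, hm₁, hm₂, hc, hu, rfl⟩, hs₁, ?_, fun x hx => ?_⟩
    · rw [GPath.tgt_append hc]
      exact ht₂
    · exact Assignment.union_apply_of_unify hu
        ((Finset.mem_union.1 hx).imp (hν₁ x) (hν₂ x))

/-- Stated abstractly so that it serves both patterns and queries. -/
theorem exists_fresh {T : Type*} {vars : T → Finset Var} {p₁ p₂ : T → Prop} {V₁ V₂ : Finset Var}
    (h₁ : ∀ F, ∃ t, p₁ t ∧ vars t ∩ F ⊆ V₁) (h₂ : ∀ F, ∃ t, p₂ t ∧ vars t ∩ F ⊆ V₂)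
    (F : Finset Var) : ∃ t₁ t₂, p₁ t₁ ∧ p₂ t₂ ∧ vars t₁ ∩ vars t₂ ⊆ V₁ ∩ V₂ ∧
      (vars t₁ ∪ vars t₂) ∩ F ⊆ V₁ ∪ V₂ := by
  -- The second expression may be forced to use `V₂`, so the first one has to avoid it in advance;
  -- the second then avoids all variables of the first.
  obtain ⟨t₁, hp₁, hF₁⟩ := h₁ (F ∪ V₂)
  obtain ⟨t₂, hp₂, hF₂⟩ := h₂ (F ∪ vars t₁)
  refine ⟨t₁, t₂, hp₁, hp₂, fun x hx => ?_, fun x hx => ?_⟩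
  · have h2 := @hF₂ x
    have h1 := @hF₁ x
    simp only [Finset.mem_inter, Finset.mem_union] at *
    tauto
  · have h2 := @hF₂ x
    have h1 := @hF₁ x
    simp only [Finset.mem_inter, Finset.mem_union] at *
    tauto

theorem PatternDefinable.concat {V₁ V₂ : Finset Var} {R₁ R₂ : PathRel.{a, b, c, d, e, f} L K C}
    (h₁ : PatternDefinable V₁ R₁) (h₂ : PatternDefinable V₂ R₂) :
    PatternDefinable (V₁ ∪ V₂) (fun _ _ _ G u v ν => ∃ w, R₁ G u w ν ∧ R₂ G w v ν : PathRel.{a, b, c, d, e, f} L K C) := by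
  intro F
  obtain ⟨π₁, π₂, hπ₁, hπ₂, hV, hF⟩ := exists_fresh h₁ h₂ F
  exact ⟨.concat π₁ π₂, hπ₁.concat hπ₂ hV, hF⟩

theorem Pattern.Defines.exists_valuation {π : Pattern L K C} {V : Finset Var} {R : PathRel.{a, b, c, d, e, f} L K C}
    (h : π.Defines V R) {N : Type a} {Ed : Type b} {Eu : Type c}
    {G : PropertyGraph N Ed Eu L K C} {m : Match N Ed Eu} (hm : m ∈ π.sem G) :
    ∃ ν : Var → N, ∀ x ∈ V, m.2 x = some (.node (ν x)) := by
  have : ∀ x, ∃ u, x ∈ V → m.2 x = some (.node u) := fun x => by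
    by_cases hx : x ∈ V
    · obtain ⟨u, hu⟩ := h.bound G m hm x hx
      exact ⟨u, fun _ => hu⟩
    -- Outside `V` the value is irrelevant; the path of the match supplies some node.
    · exact ⟨m.1.src, fun h => absurd h hx⟩
  choose ν hν using this
  exact ⟨ν, hν⟩

/-- Node variables can be projected away, provided that they can be chosen freely. -/
theorem PatternDefinable.project {R : PathRel.{a, b, c, d, e, f} L K C} (h : ∀ F : Finset Var, ∃ (V : Finset Var) (R' : PathRel.{a, b, c, d, e, f} L K C),
      V ∩ F = ∅ ∧ PatternDefinable V R' ∧
      ∀ ⦃N : Type a⦄ ⦃Ed : Type b⦄ ⦃Eu : Type c⦄ (G : PropertyGraph N Ed Eu L K C) u v ν, R G u v ν ↔ ∃ ν', R' G u v ν') :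
    PatternDefinable ∅ R := by
  intro F
  obtain ⟨V, R', hV, hd, hR⟩ := h F
  obtain ⟨π, hπ, hF⟩ := hd F
  refine ⟨π, ⟨by simp, by simp, hπ.typed, by simp, ?_, ?_⟩, fun x hx => ?_⟩
  · intro N Ed Eu G m hm ν _
    obtain ⟨ν', hν'⟩ := hπ.exists_valuation hm
    exact (hR _ _ _ _).2 ⟨ν', hπ.sound G m hm ν' hν'⟩
  · intro N Ed Eu G u v ν h
    obtain ⟨ν', h⟩ := (hR _ _ _ _).1 h
    obtain ⟨m, hm, hs, ht, -⟩ := hπ.complete G u v ν' h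
    exact ⟨m, hm, hs, ht, by simp⟩
  -- The former node variables now count as auxiliary ones, and they are fresh because `V` was
  -- chosen disjoint from `F`.
  · rw [← hV]
    exact Finset.mem_inter.2 ⟨hF hx, (Finset.mem_inter.1 hx).2⟩

/-- No node variables are kept: one that occurs on a single side would get a `Maybe` type. Freshness
makes the two sides disjoint, so every variable is typed by one of the last two typing rules for
unions. -/
theorem PatternDefinable.union {R₁ R₂ : PathRel.{a, b, c, d, e, f} L K C} (h₁ : PatternDefinable ∅ R₁)
    (h₂ : PatternDefinable ∅ R₂) :
    PatternDefinable ∅ (fun _ _ _ G u v ν => R₁ G u v ν ∨ R₂ G u v ν : PathRel.{a, b, c, d, e, f} L K C) := by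
  intro F
  obtain ⟨π₁, π₂, hπ₁, hπ₂, hV, hF⟩ := exists_fresh h₁ h₂ F
  refine ⟨.union π₁ π₂, ⟨by simp, by simp, ?_, by simp, ?_, ?_⟩, hF⟩
  · intro z hz
    rcases Finset.mem_union.1 hz with hz | hz
    · obtain ⟨τ, hτ⟩ := hπ₁.typed z hz
      refine ⟨τ.opt, .inr (.inr (.inr (.inl ⟨τ, rfl, hτ, fun h => ?_⟩)))⟩
      simpa using hV (Finset.mem_inter.2 ⟨hz, h⟩)
    · obtain ⟨τ, hτ⟩ := hπ₂.typed z hz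
      refine ⟨τ.opt, .inr (.inr (.inr (.inr ⟨τ, rfl, hτ, fun h => ?_⟩)))⟩
      simpa using hV (Finset.mem_inter.2 ⟨h, hz⟩)
  · rintro N Ed Eu G _ ⟨p, μ, hp | hp, rfl⟩ ν -
    · exact .inl (hπ₁.sound G _ hp ν (by simp))
    · exact .inr (hπ₂.sound G _ hp ν (by simp))
  · rintro N Ed Eu G u v ν (h | h)
    · obtain ⟨⟨p, μ⟩, hm, hs, ht, -⟩ := hπ₁.complete G u v ν h
      exact ⟨_, ⟨p, μ, .inl hm, rfl⟩, hs, ht, by simp⟩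
    · obtain ⟨⟨p, μ⟩, hm, hs, ht, -⟩ := hπ₂.complete G u v ν h
      exact ⟨_, ⟨p, μ, .inr hm, rfl⟩, hs, ht, by simp⟩

/-- No node variables are kept, since repetition turns them into group variables. -/
theorem PatternDefinable.transGen {R : NodeRel.{a, b, c, d, e, f} L K C}
    (h : PatternDefinable ∅ (fun _ _ _ G u v _ => R G u v : PathRel.{a, b, c, d, e, f} L K C)) :
    PatternDefinable ∅ (fun _ _ _ G u v _ => Relation.TransGen (R G) u v : PathRel.{a, b, c, d, e, f} L K C) := by
  intro F
  obtain ⟨π, hπ, hF⟩ := h F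
  have key : ∀ ⦃N : Type a⦄ ⦃Ed : Type b⦄ ⦃Eu : Type c⦄ (G : PropertyGraph N Ed Eu L K C),
      endpointRel (π.sem G) = R G := fun N Ed Eu G => by
    funext u v
    refine propext ⟨?_, fun h => ?_⟩
    · rintro ⟨m, hm, rfl, rfl⟩
      exact hπ.sound G m hm (fun _ => m.1.src) (by simp)
    · obtain ⟨m, hm, hs, ht, -⟩ := hπ.complete G u v (fun _ => u) h
      exact ⟨m, hm, hs, ht⟩
  -- The lower bound is `1`, as the zeroth power would add the identity.
  refine ⟨.rep π 1 ⊤ le_top, ⟨by simp, by simp, ?_, by simp, ?_, ?_⟩, hF⟩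
  · intro z hz
    obtain ⟨τ, hτ⟩ := hπ.typed z hz
    exact ⟨τ.group, τ, rfl, hτ⟩
  · rintro N Ed Eu G m ⟨i, hi, -, hm⟩ ν -
    rw [← key, ← endpointRel_power_iff π.vars]
    exact ⟨i, hi, m, hm, rfl, rfl⟩
  · rintro N Ed Eu G u v ν h
    rw [← key, ← endpointRel_power_iff π.vars] at h
    obtain ⟨i, hi, m, hm, hs, ht⟩ := h
    exact ⟨m, ⟨i, hi, le_top, hm⟩, hs, ht, by simp⟩

/-- `R` and its converse are defined by patterns. -/
def BiDefinable (R : NodeRel.{a, b, c, d, e, f} L K C) : Prop :=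
  PatternDefinable ∅ (fun _ _ _ G u v _ => R G u v : PathRel.{a, b, c, d, e, f} L K C) ∧
  PatternDefinable ∅ (fun _ _ _ G u v _ => R G v u : PathRel.{a, b, c, d, e, f} L K C)

theorem BiDefinable.congr {R R' : NodeRel.{a, b, c, d, e, f} L K C} (h : BiDefinable R)
    (hR : ∀ ⦃N : Type a⦄ ⦃Ed : Type b⦄ ⦃Eu : Type c⦄ (G : PropertyGraph N Ed Eu L K C) u v, R G u v ↔ R' G u v) :
    BiDefinable R' := by
  obtain rfl : R = R' := by
    funext N Ed Eu G u v
    exact propext (hR G u v)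
  exact h

theorem BiDefinable.symm {R : NodeRel.{a, b, c, d, e, f} L K C} (h : BiDefinable R) : BiDefinable (fun _ _ _ G u v => R G v u : NodeRel.{a, b, c, d, e, f} L K C) :=
  ⟨h.2, h.1⟩

theorem biDefinable_id : BiDefinable (fun _ _ _ _ u v => u = v : NodeRel.{a, b, c, d, e, f} L K C) :=
  ⟨patternDefinable_id, patternDefinable_id.congr fun _ _ _ _ _ _ _ => eq_comm⟩

theorem biDefinable_label (A : L) :
    BiDefinable (fun _ _ _ G u v => u = v ∧ A ∈ G.label (.inl u) : NodeRel.{a, b, c, d, e, f} L K C) :=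
  ⟨patternDefinable_label A, (patternDefinable_label A).congr fun _ _ _ _ _ _ _ =>
    ⟨fun h => ⟨h.1.symm, h.1 ▸ h.2⟩, fun h => ⟨h.1.symm, h.1 ▸ h.2⟩⟩⟩

theorem biDefinable_edge (l : L) : BiDefinable (fun _ _ _ G u v => EdgeRel G l u v : NodeRel.{a, b, c, d, e, f} L K C) :=
  ⟨patternDefinable_fwd l, patternDefinable_bwd l⟩

theorem biDefinable_letter (s : Letter L) : BiDefinable (fun _ _ _ G u v => s.Rel G u v : NodeRel.{a, b, c, d, e, f} L K C) := by
  cases s with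
  | fwd l => exact biDefinable_edge l
  | bwd l => exact (biDefinable_edge l).symm

theorem BiDefinable.comp {R₁ R₂ : NodeRel.{a, b, c, d, e, f} L K C} (h₁ : BiDefinable R₁) (h₂ : BiDefinable R₂) :
    BiDefinable (fun _ _ _ G u v => ∃ w, R₁ G u w ∧ R₂ G w v : NodeRel.{a, b, c, d, e, f} L K C) :=
  ⟨h₁.1.concat h₂.1, (h₂.2.concat h₁.2).congr fun _ _ _ _ _ _ _ =>
    exists_congr fun _ => and_comm⟩

theorem BiDefinable.union {R₁ R₂ : NodeRel.{a, b, c, d, e, f} L K C} (h₁ : BiDefinable R₁) (h₂ : BiDefinable R₂) :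
    BiDefinable (fun _ _ _ G u v => R₁ G u v ∨ R₂ G u v : NodeRel.{a, b, c, d, e, f} L K C) :=
  ⟨h₁.1.union h₂.1, h₁.2.union h₂.2⟩

theorem BiDefinable.transGen {R : NodeRel.{a, b, c, d, e, f} L K C} (h : BiDefinable R) :
    BiDefinable (fun _ _ _ G u v => Relation.TransGen (R G) u v : NodeRel.{a, b, c, d, e, f} L K C) :=
  ⟨h.1.transGen, (PatternDefinable.transGen (R := fun _ _ _ G u v => R G v u) h.2).congr
    fun _ _ _ _ _ _ _ => Relation.transGen_swap⟩

theorem BiDefinable.reflTransGen {R : NodeRel.{a, b, c, d, e, f} L K C} (h : BiDefinable R) :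
    BiDefinable (fun _ _ _ G u v => Relation.ReflTransGen (R G) u v : NodeRel.{a, b, c, d, e, f} L K C) :=
  (biDefinable_id.union h.transGen).congr fun _ _ _ _ u v => by
    rw [Relation.reflTransGen_iff_eq_or_transGen, eq_comm]

end Definability

section Walks
variable {L : Type d} {K : Type e} {C : Type f}

/-! ### Connected conjunctive queries as walks -/

/-- `φ` describes the valuations of some node variables from `S` along the matches of a pattern
whose endpoints are bound to `x` and `y`. -/
def WalkDefinable (S : Set Var) (x y : Var) (φ : TupleRel.{a, b, c, d, e, f} L K C Var) : Prop :=
  ∃ V : Finset Var, ↑V ⊆ S ∧ x ∈ V ∧ y ∈ V ∧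
    PatternDefinable V (fun _ _ _ G u v ν => ν x = u ∧ ν y = v ∧ φ G ν : PathRel.{a, b, c, d, e, f} L K C)

theorem WalkDefinable.congr {S : Set Var} {x y : Var} {φ ψ : TupleRel.{a, b, c, d, e, f} L K C Var} (h : WalkDefinable S x y φ)
    (hφ : ∀ ⦃N : Type a⦄ ⦃Ed : Type b⦄ ⦃Eu : Type c⦄ (G : PropertyGraph N Ed Eu L K C) ν, φ G ν ↔ ψ G ν) :
    WalkDefinable S x y ψ := by
  obtain rfl : φ = ψ := by
    funext N Ed Eu G ν
    exact propext (hφ G ν)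
  exact h

theorem walkDefinable_refl {S : Set Var} {x : Var} (hx : x ∈ S) :
    WalkDefinable S x x (fun _ _ _ _ _ => True : TupleRel.{a, b, c, d, e, f} L K C Var) :=
  ⟨{x}, by simpa using hx, by simp, by simp, (patternDefinable_node x).congr (by simp)⟩

/-- The sets `V₁` and `V₂` may overlap beyond `y`: a walk that revisits a variable is forced to
return to the same node. -/
theorem WalkDefinable.comp {S : Set Var} {x y z : Var} {φ ψ : TupleRel.{a, b, c, d, e, f} L K C Var}
    (h₁ : WalkDefinable S x y φ) (h₂ : WalkDefinable S y z ψ) :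
    WalkDefinable S x z (fun _ _ _ G ν => φ G ν ∧ ψ G ν : TupleRel.{a, b, c, d, e, f} L K C Var) := by
  obtain ⟨V₁, hS₁, hx, -, h₁⟩ := h₁
  obtain ⟨V₂, hS₂, -, hz, h₂⟩ := h₂
  refine ⟨V₁ ∪ V₂, by simp [hS₁, hS₂], Finset.mem_union_left _ hx, Finset.mem_union_right _ hz,
    (h₁.concat h₂).congr fun N Ed Eu G u v ν => ⟨?_, ?_⟩⟩
  · rintro ⟨w, ⟨h1, -, h2⟩, -, h3, h4⟩
    exact ⟨h1, h3, h2, h4⟩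
  · rintro ⟨h1, h2, h3, h4⟩
    exact ⟨ν y, ⟨h1, rfl, h3⟩, rfl, h2, h4⟩

theorem BiDefinable.walkDefinable {R : NodeRel.{a, b, c, d, e, f} L K C} (h : BiDefinable R) {S : Set Var} {x y : Var}
    (hx : x ∈ S) (hy : y ∈ S) :
    WalkDefinable S x y (fun _ _ _ G ν => R G (ν x) (ν y) : TupleRel.{a, b, c, d, e, f} L K C Var) := by
  refine ⟨{x} ∪ (∅ ∪ {y}), ?_, by simp, by simp, ((patternDefinable_node x).concat
    (h.1.concat (patternDefinable_node y))).congr fun N Ed Eu G u v ν => ⟨?_, ?_⟩⟩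
  · simp [Set.insert_subset_iff, hx, hy]
  · rintro ⟨_, ⟨rfl, rfl⟩, _, h, rfl, rfl⟩
    exact ⟨rfl, rfl, h⟩
  · rintro ⟨rfl, rfl, h⟩
    exact ⟨_, ⟨rfl, rfl⟩, _, h, rfl, rfl⟩

set_option linter.checkUnivs false in
/-- An atom `R(x, y)` for a relation `R` that is, with its converse, defined by patterns. -/
structure RelAtom (L : Type d) (K : Type e) (C : Type f) (ι : Type) where
  rel : NodeRel.{a, b, c, d, e, f} L K C
  biDefinable : BiDefinable rel
  x : ι
  y : ι

namespace RelAtom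
variable {ι κ : Type}

def Holds {N : Type a} {Ed : Type b} {Eu : Type c} (G : PropertyGraph N Ed Eu L K C) (ν : ι → N)
    (α : RelAtom.{a, b, c, d, e, f} L K C ι) : Prop :=
  α.rel G (ν α.x) (ν α.y)

def map (g : ι → κ) (α : RelAtom.{a, b, c, d, e, f} L K C ι) :
    RelAtom.{a, b, c, d, e, f} L K C κ :=
  ⟨α.rel, α.biDefinable, g α.x, g α.y⟩

theorem map_holds {N : Type a} {Ed : Type b} {Eu : Type c} {G : PropertyGraph N Ed Eu L K C}
    {g : ι → κ} {ν : κ → N} {α : RelAtom.{a, b, c, d, e, f} L K C ι} :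
    (α.map g).Holds G ν ↔ α.Holds G (ν ∘ g) :=
  Iff.rfl

/-- Two variables occur together in an atom. -/
def Adj (A : List (RelAtom.{a, b, c, d, e, f} L K C ι)) (x y : ι) : Prop :=
  ∃ α ∈ A, (α.x = x ∧ α.y = y) ∨ (α.x = y ∧ α.y = x)

/-- Two variables are connected by a sequence of atoms. -/
abbrev Conn (A : List (RelAtom.{a, b, c, d, e, f} L K C ι)) : ι → ι → Prop :=
  Relation.ReflTransGen (Adj A)

/-- The formula `φ` is the conjunction of the atoms crossed on the way, so it follows from `A`. The
same walk taken backwards uses the converse relations and has the same formula. -/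
theorem exists_walk {A : List (RelAtom.{a, b, c, d, e, f} L K C Var)} {S : Set Var}
    (hS : ∀ α ∈ A, α.x ∈ S ∧ α.y ∈ S) {x y : Var} (hx : x ∈ S) (h : Conn A x y) :
    y ∈ S ∧ ∃ φ : TupleRel.{a, b, c, d, e, f} L K C Var, WalkDefinable S x y φ ∧ WalkDefinable S y x φ ∧
      ∀ ⦃N : Type a⦄ ⦃Ed : Type b⦄ ⦃Eu : Type c⦄ (G : PropertyGraph N Ed Eu L K C) ν, (∀ α ∈ A, α.Holds G ν) → φ G ν := by
  induction h with
  | refl => exact ⟨hx, _, walkDefinable_refl hx, walkDefinable_refl hx, fun _ _ _ _ _ _ => trivial⟩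
  | tail _ hyz ih =>
    obtain ⟨hy, φ, h₁, h₂, hφ⟩ := ih
    obtain ⟨⟨R, hR, p, q⟩, hα, ⟨rfl, rfl⟩ | ⟨rfl, rfl⟩⟩ := hyz
    · have hz := (hS _ hα).2
      exact ⟨hz, _, h₁.comp (hR.walkDefinable hy hz),
        ((hR.symm.walkDefinable hz hy).comp h₂).congr fun _ _ _ _ _ => and_comm,
        fun _ _ _ G ν h => ⟨hφ G ν h, h _ hα⟩⟩
    · have hz := (hS _ hα).1
      exact ⟨hz, _, h₁.comp (hR.symm.walkDefinable hy hz),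
        ((hR.walkDefinable hz hy).comp h₂).congr fun _ _ _ _ _ => and_comm,
        fun _ _ _ G ν h => ⟨hφ G ν h, h _ hα⟩⟩

/-- For each atom of `B` the walk goes from `x` to its first variable, crosses it, and returns to
`x`. The detours impose only consequences of `A`. -/
theorem exists_closed_walk {A : List (RelAtom.{a, b, c, d, e, f} L K C Var)} {S : Set Var}
    (hS : ∀ α ∈ A, α.x ∈ S ∧ α.y ∈ S) {x : Var} (hx : x ∈ S) (hA : ∀ α ∈ A, Conn A x α.x)
    (B : List (RelAtom.{a, b, c, d, e, f} L K C Var)) (hB : B ⊆ A) :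
    ∃ φ : TupleRel.{a, b, c, d, e, f} L K C Var, WalkDefinable S x x φ ∧
      ∀ ⦃N : Type a⦄ ⦃Ed : Type b⦄ ⦃Eu : Type c⦄ (G : PropertyGraph N Ed Eu L K C) ν, ((∀ α ∈ A, α.Holds G ν) → φ G ν) ∧
        (φ G ν → ∀ α ∈ B, α.Holds G ν) := by
  induction B with
  | nil => exact ⟨_, walkDefinable_refl hx, fun _ _ _ _ _ => ⟨fun _ => trivial, by simp⟩⟩
  | cons β B ih =>
    obtain ⟨φ, hφ, hφ'⟩ := ih fun α hα => hB (List.mem_cons_of_mem _ hα)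
    have hβ : β ∈ A := hB (by simp)
    obtain ⟨-, ψ, h₁, -, hψ⟩ := exists_walk hS hx (hA β hβ)
    obtain ⟨-, χ, -, h₂, hχ⟩ := exists_walk hS hx
      ((hA β hβ).tail ⟨β, hβ, .inl ⟨rfl, rfl⟩⟩)
    refine ⟨_, h₁.comp ((β.biDefinable.walkDefinable (hS β hβ).1 (hS β hβ).2).comp
      (h₂.comp hφ)), fun N Ed Eu G ν => ⟨fun h => ⟨hψ G ν h, h β hβ, hχ G ν h,
        (hφ' G ν).1 h⟩, ?_⟩⟩
    rintro ⟨-, h1, -, h2⟩ α hα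
    rcases List.mem_cons.1 hα with rfl | hα
    exacts [h1, (hφ' G ν).2 h2 α hα]

/-- The closed walk through all of `A` enforces exactly `A`; a walk between `x` and `y` appended or
prepended to it adds nothing new. -/
theorem walkDefinable_of_conn {A : List (RelAtom.{a, b, c, d, e, f} L K C Var)} {S : Set Var}
    (hS : ∀ α ∈ A, α.x ∈ S ∧ α.y ∈ S) {x y : Var} (hx : x ∈ S) (hA : ∀ α ∈ A, Conn A x α.x)
    (hxy : Conn A x y) :
    WalkDefinable S x y (fun _ _ _ G ν => ∀ α ∈ A, α.Holds G ν : TupleRel.{a, b, c, d, e, f} L K C Var) ∧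
      WalkDefinable S y x (fun _ _ _ G ν => ∀ α ∈ A, α.Holds G ν : TupleRel.{a, b, c, d, e, f} L K C Var) := by
  obtain ⟨φ, h, hφ⟩ := exists_closed_walk hS hx hA A (fun _ h => h)
  obtain ⟨-, ψ, h₁, h₂, hψ⟩ := exists_walk hS hx hxy
  exact ⟨(h.comp h₁).congr fun _ _ _ G ν => ⟨fun h => (hφ G ν).2 h.1,
      fun h => ⟨(hφ G ν).1 h, hψ G ν h⟩⟩,
    (h₂.comp h).congr fun _ _ _ G ν => ⟨fun h => (hφ G ν).2 h.2,
      fun h => ⟨hψ G ν h, (hφ G ν).1 h⟩⟩⟩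

theorem conn_map (g : ι → κ) {A : List (RelAtom.{a, b, c, d, e, f} L K C ι)} {x y : ι}
    (h : Conn A x y) : Conn (A.map (map g)) (g x) (g y) := by
  refine Relation.ReflTransGen.lift g ?_ _ _ h
  rintro u v ⟨α, hα, h⟩
  refine ⟨α.map g, List.mem_map_of_mem hα, ?_⟩
  rcases h with ⟨rfl, rfl⟩ | ⟨rfl, rfl⟩
  exacts [.inl ⟨rfl, rfl⟩, .inr ⟨rfl, rfl⟩]

/-- The walk between `x` and `y` is written with variables renamed away from a given finite set,
which can therefore be projected away. The two directions of the walk give the relation and its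
converse. -/
theorem biDefinable_of_conn [Encodable ι] {A : List (RelAtom.{a, b, c, d, e, f} L K C ι)}
    {x y : ι} (hA : ∀ α ∈ A, Conn A x α.x) (hxy : Conn A x y) :
    BiDefinable (fun _ _ _ G u v => ∃ ρ : ι → _, ρ x = u ∧ ρ y = v ∧ ∀ α ∈ A, α.Holds G ρ : NodeRel.{a, b, c, d, e, f} L K C) := by
  have key : ∀ F : Finset Var, ∃ g : ι → Var, g.Injective ∧ ∀ i, g i ∉ F := by
    -- The shift exceeds every element of `F`.
    refine fun F => ⟨fun i => Encodable.encode i + (F.sup id + 1), fun i j hij => ?_, fun i hi => ?_⟩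
    · exact Encodable.encode_injective (by simpa using hij)
    · have h : Encodable.encode i + (F.sup id + 1) ≤ F.sup id := Finset.le_sup (f := id) hi
      omega
  have aux : ∀ (F : Finset Var) (p q : ι), (∀ g : ι → Var, WalkDefinable (Set.range g) (g p) (g q)
      (fun _ _ _ G ν => ∀ α ∈ A, α.Holds G (ν ∘ g) : TupleRel.{a, b, c, d, e, f} L K C Var)) →
      ∃ (V : Finset Var) (R' : PathRel.{a, b, c, d, e, f} L K C), V ∩ F = ∅ ∧ PatternDefinable V R' ∧
      ∀ ⦃N : Type a⦄ ⦃Ed : Type b⦄ ⦃Eu : Type c⦄ (G : PropertyGraph N Ed Eu L K C) u v (ν : Var → N),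
        (∃ ρ : ι → N, ρ p = u ∧ ρ q = v ∧ ∀ α ∈ A, α.Holds G ρ) ↔ ∃ ν', R' G u v ν' := by
    intro F p q h
    obtain ⟨g, hg, hF⟩ := key F
    obtain ⟨V, hV, -, -, hd⟩ := h g
    refine ⟨V, _, ?_, hd, ?_⟩
    · ext z
      simp only [Finset.mem_inter, Finset.notMem_empty, iff_false, not_and]
      intro hz
      obtain ⟨i, rfl⟩ := hV hz
      exact hF i
    · intro N Ed Eu G u v _
      have : Nonempty N := ⟨u⟩
      constructor
      · rintro ⟨ρ, rfl, rfl, h⟩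
        -- As `g` is injective and there is a node, a valuation of `ι` extends to all variables.
        obtain ⟨ν, rfl⟩ := hg.surjective_comp_right ρ
        exact ⟨ν, rfl, rfl, h⟩
      · rintro ⟨ν, rfl, rfl, h⟩
        exact ⟨ν ∘ g, rfl, rfl, h⟩
  have walks : ∀ g : ι → Var, _ := fun g =>
    walkDefinable_of_conn (A := A.map (map g)) (S := Set.range g) (x := g x) (y := g y)
      (by simp [map]) ⟨x, rfl⟩ (by
        simp only [List.mem_map, forall_exists_index, and_imp, forall_apply_eq_imp_iff₂]
        exact fun α hα => conn_map g (hA α hα)) (conn_map g hxy)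
  constructor
  · refine PatternDefinable.project fun F => aux F x y fun g => (walks g).1.congr ?_
    intro N Ed Eu G ν
    simp [Holds, map]
  · refine PatternDefinable.project fun F => ?_
    obtain ⟨V, R', hV, hd, hR⟩ := aux F y x fun g => (walks g).2.congr (by
      intro N Ed Eu G ν
      simp [Holds, map])
    refine ⟨V, R', hV, hd, fun N Ed Eu G u v ν => (Iff.trans ?_ (hR G u v ν))⟩
    exact exists_congr fun _ => and_left_comm

end RelAtom

end Walks

section Tuples
variable {L : Type d} {K : Type e} {C : Type f} {ι κ : Type}

/-! ### Unions of conjunctive queries -/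

/-- `φ` is a finite union of conjunctive queries over relations that are, with their converses,
defined by patterns.  The bound variables are numbers. -/
def TupleDefinable (φ : TupleRel.{a, b, c, d, e, f} L K C ι) : Prop :=
  ∃ l : List (List (RelAtom.{a, b, c, d, e, f} L K C (ι ⊕ ℕ))),
    ∀ ⦃N : Type a⦄ ⦃Ed : Type b⦄ ⦃Eu : Type c⦄ (G : PropertyGraph N Ed Eu L K C) (t : ι → N),
      φ G t ↔ ∃ A ∈ l, ∃ ν : ℕ → N, ∀ β ∈ A, β.Holds G (Sum.elim t ν)

namespace TupleDefinable

theorem congr {φ ψ : TupleRel.{a, b, c, d, e, f} L K C ι} (h : TupleDefinable φ)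
    (hφ : ∀ ⦃N : Type a⦄ ⦃Ed : Type b⦄ ⦃Eu : Type c⦄ (G : PropertyGraph N Ed Eu L K C) (t : ι → N), φ G t ↔ ψ G t) :
    TupleDefinable ψ := by
  obtain rfl : φ = ψ := by
    funext N Ed Eu G t
    exact propext (hφ G t)
  exact h

theorem subst {φ : TupleRel.{a, b, c, d, e, f} L K C ι} (h : TupleDefinable φ) (g : ι → κ) :
    TupleDefinable (fun _ _ _ G t => φ G (t ∘ g) : TupleRel.{a, b, c, d, e, f} L K C κ) := by
  obtain ⟨l, hl⟩ := h
  refine ⟨l.map fun A => A.map (RelAtom.map (Sum.map g id)), fun N Ed Eu G t => ?_⟩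
  simp only [hl, List.mem_map, exists_exists_and_eq_and, forall_exists_index, and_imp,
    forall_apply_eq_imp_iff₂, RelAtom.map_holds, Sum.elim_comp_map, Function.comp_id]

theorem bot : TupleDefinable (fun _ _ _ _ _ => False : TupleRel.{a, b, c, d, e, f} L K C ι) :=
  ⟨[], by simp⟩

theorem or {φ ψ : TupleRel.{a, b, c, d, e, f} L K C ι} (h₁ : TupleDefinable φ) (h₂ : TupleDefinable ψ) :
    TupleDefinable (fun _ _ _ G t => φ G t ∨ ψ G t : TupleRel.{a, b, c, d, e, f} L K C ι) := by
  obtain ⟨l₁, hl₁⟩ := h₁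
  obtain ⟨l₂, hl₂⟩ := h₂
  refine ⟨l₁ ++ l₂, fun N Ed Eu G t => ?_⟩
  simp only [hl₁, hl₂, List.mem_append, or_and_right, exists_or]

theorem and {φ ψ : TupleRel.{a, b, c, d, e, f} L K C ι} (h₁ : TupleDefinable φ) (h₂ : TupleDefinable ψ) :
    TupleDefinable (fun _ _ _ G t => φ G t ∧ ψ G t : TupleRel.{a, b, c, d, e, f} L K C ι) := by
  obtain ⟨l₁, hl₁⟩ := h₁
  obtain ⟨l₂, hl₂⟩ := h₂
  -- Keeps the bound variables of the two conjuncts apart.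
  let η : ℕ ⊕ ℕ ≃ ℕ := Equiv.natSumNatEquivNat
  refine ⟨l₁.flatMap fun A₁ => l₂.map fun A₂ =>
    A₁.map (RelAtom.map (Sum.map id (η ∘ Sum.inl))) ++
      A₂.map (RelAtom.map (Sum.map id (η ∘ Sum.inr))), fun N Ed Eu G t => ?_⟩
  beta_reduce
  rw [hl₁, hl₂]
  constructor
  · rintro ⟨⟨A₁, hA₁, ν₁, h₁⟩, A₂, hA₂, ν₂, h₂⟩
    refine ⟨_, List.mem_flatMap.2 ⟨A₁, hA₁, List.mem_map.2 ⟨A₂, hA₂, rfl⟩⟩,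
      Sum.elim ν₁ ν₂ ∘ η.symm, fun β hβ => ?_⟩
    rcases List.mem_append.1 hβ with hβ | hβ <;> obtain ⟨β, hβ', rfl⟩ := List.mem_map.1 hβ
    · have e : (Sum.elim ν₁ ν₂ ∘ η.symm) ∘ η ∘ Sum.inl = ν₁ := by
        ext i
        simp
      rw [RelAtom.map_holds, Sum.elim_comp_map, e]
      exact h₁ β hβ'
    · have e : (Sum.elim ν₁ ν₂ ∘ η.symm) ∘ η ∘ Sum.inr = ν₂ := by
        ext i
        simp
      rw [RelAtom.map_holds, Sum.elim_comp_map, e]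
      exact h₂ β hβ'
  · rintro ⟨A, hA, ν, h⟩
    obtain ⟨A₁, hA₁, hA⟩ := List.mem_flatMap.1 hA
    obtain ⟨A₂, hA₂, rfl⟩ := List.mem_map.1 hA
    refine ⟨⟨A₁, hA₁, ν ∘ η ∘ Sum.inl, fun β hβ => ?_⟩,
      A₂, hA₂, ν ∘ η ∘ Sum.inr, fun β hβ => ?_⟩
    · have := h _ (List.mem_append_left _ (List.mem_map_of_mem hβ))
      rwa [RelAtom.map_holds, Sum.elim_comp_map] at this
    · have := h _ (List.mem_append_right _ (List.mem_map_of_mem hβ))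
      rwa [RelAtom.map_holds, Sum.elim_comp_map] at this

/-- A whole sequence of nodes is quantified, so that the bound variables of a rule body can be bound
all at once; `η` merges it with the sequence already bound. -/
theorem ex {φ : TupleRel.{a, b, c, d, e, f} L K C (ι ⊕ ℕ)} (h : TupleDefinable φ) :
    TupleDefinable (fun _ _ _ G t => ∃ ν : ℕ → _, φ G (Sum.elim t ν) : TupleRel.{a, b, c, d, e, f} L K C ι) := by
  obtain ⟨l, hl⟩ := h
  let η : ℕ ⊕ ℕ ≃ ℕ := Equiv.natSumNatEquivNat
  let g : (ι ⊕ ℕ) ⊕ ℕ → ι ⊕ ℕ :=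
    Sum.elim (Sum.elim Sum.inl (Sum.inr ∘ η ∘ Sum.inl)) (Sum.inr ∘ η ∘ Sum.inr)
  refine ⟨l.map fun A => A.map (RelAtom.map g), fun N Ed Eu G t => ?_⟩
  simp only [hl, List.mem_map, exists_exists_and_eq_and, forall_exists_index, and_imp,
    forall_apply_eq_imp_iff₂, RelAtom.map_holds]
  constructor
  · rintro ⟨ν₁, A, hA, ν₂, h⟩
    refine ⟨A, hA, Sum.elim ν₁ ν₂ ∘ η.symm, fun β hβ => ?_⟩
    have e : Sum.elim t (Sum.elim ν₁ ν₂ ∘ η.symm) ∘ g = Sum.elim (Sum.elim t ν₁) ν₂ := by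
      ext ((i | i) | i) <;> simp [g]
    rw [e]
    exact h β hβ
  · rintro ⟨A, hA, ν, h⟩
    refine ⟨ν ∘ η ∘ Sum.inl, A, hA, ν ∘ η ∘ Sum.inr, fun β hβ => ?_⟩
    have e : Sum.elim t ν ∘ g = Sum.elim (Sum.elim t (ν ∘ η ∘ Sum.inl)) (ν ∘ η ∘ Sum.inr) := by
      ext ((i | i) | i) <;> simp [g]
    rw [← e]
    exact h β hβ

theorem ofBiDefinable {R : NodeRel.{a, b, c, d, e, f} L K C} (h : BiDefinable R) (i j : ι) :
    TupleDefinable (fun _ _ _ G t => R G (t i) (t j) : TupleRel.{a, b, c, d, e, f} L K C ι) := by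
  refine ⟨[[⟨R, h, .inl i, .inl j⟩]], fun N Ed Eu G t => ?_⟩
  simp only [List.mem_singleton, exists_eq_left, forall_eq]
  exact ⟨fun h => ⟨fun _ => t i, h⟩, fun ⟨_, h⟩ => h⟩

theorem eq (i j : ι) : TupleDefinable (fun _ _ _ _ t => t i = t j : TupleRel.{a, b, c, d, e, f} L K C ι) :=
  ofBiDefinable biDefinable_id i j

/-- For empty `ι` the empty conjunction is true even on a graph without nodes, where no query of the
normal form holds, as it asks for `ν : ℕ → N`. -/
theorem forall_mem [Nonempty ι] {T : Type*} (l : List T) {φ : T → TupleRel.{a, b, c, d, e, f} L K C ι}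
    (h : ∀ x ∈ l, TupleDefinable (φ x)) :
    TupleDefinable (fun _ _ _ G t => ∀ x ∈ l, φ x G t : TupleRel.{a, b, c, d, e, f} L K C ι) := by
  induction l with
  | nil =>
    obtain ⟨i⟩ := ‹Nonempty ι›
    exact (eq i i).congr (by simp)
  | cons y l ih =>
    exact ((h y (by simp)).and (ih fun x hx => h x (List.mem_cons_of_mem _ hx))).congr (by simp)

theorem exists_mem {T : Type*} (l : List T) {φ : T → TupleRel.{a, b, c, d, e, f} L K C ι}
    (h : ∀ x ∈ l, TupleDefinable (φ x)) :
    TupleDefinable (fun _ _ _ G t => ∃ x ∈ l, φ x G t : TupleRel.{a, b, c, d, e, f} L K C ι) := by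
  induction l with
  | nil => exact bot.congr (by simp)
  | cons y l ih =>
    exact ((h y (by simp)).or (ih fun x hx => h x (List.mem_cons_of_mem _ hx))).congr (by simp)

/-- The answers to a conjunctive query. -/
theorem ofAtoms [Encodable ι] [Nonempty ι] {n : ℕ}
    (A : List (RelAtom.{a, b, c, d, e, f} L K C ι)) (g : Fin n → ι) :
    TupleDefinable (fun _ _ _ G t => ∃ ρ : ι → _, (∀ i, ρ (g i) = t i) ∧ ∀ β ∈ A, β.Holds G ρ :
      TupleRel.{a, b, c, d, e, f} L K C (Fin n)) := by
  -- All variables of the query are bound, and the free coordinates are tied to them by identity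
  -- atoms; thus `g` need not be injective.
  have h₁ : TupleDefinable (fun _ _ _ _ t => ∀ i ∈ List.finRange n,
      t (.inr (Encodable.encode (g i))) = t (.inl i) : TupleRel.{a, b, c, d, e, f} L K C (Fin n ⊕ ℕ)) :=
    forall_mem _ fun _ _ => eq _ _
  have h₂ : TupleDefinable (fun _ _ _ G t => ∀ β ∈ A,
      β.rel G (t (.inr (Encodable.encode β.x))) (t (.inr (Encodable.encode β.y))) :
      TupleRel.{a, b, c, d, e, f} L K C (Fin n ⊕ ℕ)) :=
    forall_mem _ fun β _ => ofBiDefinable β.biDefinable _ _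
  refine (h₁.and h₂).ex.congr fun N Ed Eu G t => ?_
  simp only [List.mem_finRange, true_imp_iff, Sum.elim_inl, Sum.elim_inr]
  constructor
  · rintro ⟨ν, h₁, h₂⟩
    exact ⟨ν ∘ Encodable.encode, h₁, h₂⟩
  · rintro ⟨ρ, h₁, h₂⟩
    have : Nonempty N := ‹Nonempty ι›.map ρ
    obtain ⟨ν, rfl⟩ := Encodable.encode_injective.surjective_comp_right ρ
    exact ⟨ν, h₁, h₂⟩

end TupleDefinable

/-! ### Transitive closures -/

/-- A product step does not relate its two ends, so the source of the first such step and the target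
of the last one form a product step themselves, which replaces everything in between. -/
theorem transGen_or_prod {N : Type*} {Q : N → N → Prop} {φ ψ : N → Prop} {u v : N} :
    Relation.TransGen (fun u v => Q u v ∨ (φ u ∧ ψ v)) u v ↔ Relation.TransGen Q u v ∨
      ((∃ w, Relation.ReflTransGen Q u w ∧ φ w) ∧ ∃ w, ψ w ∧ Relation.ReflTransGen Q w v) := by
  constructor
  · intro h
    induction h using Relation.TransGen.head_induction_on with
    | single h =>
      rcases h with h | ⟨h₁, h₂⟩
      · exact .inl (.single h)
      · exact .inr ⟨⟨_, .refl, h₁⟩, _, h₂, .refl⟩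
    | head h _ ih =>
      rcases h with h | ⟨h₁, h₂⟩
      · rcases ih with ih | ⟨⟨w, hw, hφ⟩, ih⟩
        · exact .inl (.head h ih)
        · exact .inr ⟨⟨w, .head h hw, hφ⟩, ih⟩
      · rcases ih with ih | ⟨-, ih⟩
        · exact .inr ⟨⟨_, .refl, h₁⟩, _, h₂, ih.to_reflTransGen⟩
        -- The new product step supplies the source condition; the target condition of the later one
        -- is kept.
        · exact .inr ⟨⟨_, .refl, h₁⟩, ih⟩
  · rintro (h | ⟨⟨w, h₁, hφ⟩, z, hψ, h₂⟩)
    · exact Relation.TransGen.mono (fun _ _ => .inl) _ _ h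
    · exact (Relation.TransGen.tail' (Relation.ReflTransGen.mono (fun _ _ => .inl) _ _ h₁)
        (.inr ⟨hφ, hψ⟩)).trans_left (Relation.ReflTransGen.mono (fun _ _ => .inl) _ _ h₂)

/-- `R` is empty or bidefinable; there is no pattern for the empty relation. -/
def EmptyOrBiDefinable (R : NodeRel.{a, b, c, d, e, f} L K C) : Prop :=
  (∀ ⦃N : Type a⦄ ⦃Ed : Type b⦄ ⦃Eu : Type c⦄ (G : PropertyGraph N Ed Eu L K C) u v, ¬ R G u v) ∨ BiDefinable R

theorem EmptyOrBiDefinable.congr {R R' : NodeRel.{a, b, c, d, e, f} L K C} (h : EmptyOrBiDefinable R)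
    (hR : ∀ ⦃N : Type a⦄ ⦃Ed : Type b⦄ ⦃Eu : Type c⦄ (G : PropertyGraph N Ed Eu L K C) u v, R G u v ↔ R' G u v) :
    EmptyOrBiDefinable R' := by
  obtain rfl : R = R' := by
    funext N Ed Eu G u v
    exact propext (hR G u v)
  exact h

theorem EmptyOrBiDefinable.union {R₁ R₂ : NodeRel.{a, b, c, d, e, f} L K C} (h₁ : EmptyOrBiDefinable R₁)
    (h₂ : EmptyOrBiDefinable R₂) :
    EmptyOrBiDefinable (fun _ _ _ G u v => R₁ G u v ∨ R₂ G u v : NodeRel.{a, b, c, d, e, f} L K C) := by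
  rcases h₁ with h₁ | h₁
  · exact h₂.congr fun _ _ _ G u v => by simp [h₁ G u v]
  · rcases h₂ with h₂ | h₂
    · exact EmptyOrBiDefinable.congr (.inr h₁) fun _ _ _ G u v => by simp [h₂ G u v]
    · exact .inr (h₁.union h₂)

theorem EmptyOrBiDefinable.comp {R₁ R₂ : NodeRel.{a, b, c, d, e, f} L K C} (h₁ : EmptyOrBiDefinable R₁)
    (h₂ : EmptyOrBiDefinable R₂) :
    EmptyOrBiDefinable (fun _ _ _ G u v => ∃ w, R₁ G u w ∧ R₂ G w v : NodeRel.{a, b, c, d, e, f} L K C) := by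
  rcases h₁ with h₁ | h₁
  · exact .inl fun _ _ _ G u v ⟨w, h, _⟩ => h₁ G u w h
  · rcases h₂ with h₂ | h₂
    · exact .inl fun _ _ _ G u v ⟨w, _, h⟩ => h₂ G w v h
    · exact .inr (h₁.comp h₂)

theorem EmptyOrBiDefinable.reflTransGen {R : NodeRel.{a, b, c, d, e, f} L K C} (h : EmptyOrBiDefinable R) :
    EmptyOrBiDefinable (fun _ _ _ G u v => Relation.ReflTransGen (R G) u v : NodeRel.{a, b, c, d, e, f} L K C) := by
  rcases h with h | h
  · refine .inr (biDefinable_id.congr fun N Ed Eu G u v => ?_)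
    constructor
    · rintro rfl
      exact .refl
    · intro h'
      rcases Relation.ReflTransGen.cases_head h' with h' | ⟨w, hw, -⟩
      exacts [h', (h G _ _ hw).elim]
  · exact .inr h.reflTransGen

theorem EmptyOrBiDefinable.tupleDefinable {R : NodeRel.{a, b, c, d, e, f} L K C} (h : EmptyOrBiDefinable R) (i j : ι) :
    TupleDefinable (fun _ _ _ G t => R G (t i) (t j) : TupleRel.{a, b, c, d, e, f} L K C ι) := by
  rcases h with h | h
  · exact TupleDefinable.bot.congr fun N Ed Eu G t => by simp [h G (t i) (t j)]
  · exact .ofBiDefinable h i j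

/-- The binary relation `Q` is a union of conjunctive queries. -/
abbrev RelDefinable (Q : NodeRel.{a, b, c, d, e, f} L K C) : Prop := TupleDefinable (fun _ _ _ G t => Q G (t 0) (t 1) : TupleRel.{a, b, c, d, e, f} L K C (Fin 2))

/-- The set of nodes `φ` is a union of conjunctive queries. -/
abbrev SetDefinable (φ : ∀ ⦃N : Type a⦄ ⦃Ed : Type b⦄ ⦃Eu : Type c⦄ (_ : PropertyGraph N Ed Eu L K C), N → Prop) : Prop :=
  TupleDefinable (fun _ _ _ G t => φ G (t 0) : TupleRel.{a, b, c, d, e, f} L K C (Fin 1))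

theorem TupleDefinable.apply₂ {Q : NodeRel.{a, b, c, d, e, f} L K C} (h : RelDefinable Q) (i j : ι) :
    TupleDefinable (fun _ _ _ G t => Q G (t i) (t j) : TupleRel.{a, b, c, d, e, f} L K C ι) :=
  h.subst ![i, j]

theorem TupleDefinable.apply₁ {φ : ∀ ⦃N : Type a⦄ ⦃Ed : Type b⦄ ⦃Eu : Type c⦄ (_ : PropertyGraph N Ed Eu L K C), N → Prop}
    (h : SetDefinable φ) (i : ι) : TupleDefinable (fun _ _ _ G t => φ G (t i) : TupleRel.{a, b, c, d, e, f} L K C ι) :=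
  h.subst ![i]

/-- The union of `P` with every bidefinable relation has a definable transitive closure. -/
def PlusDefinable (P : NodeRel.{a, b, c, d, e, f} L K C) : Prop :=
  ∀ R : NodeRel.{a, b, c, d, e, f} L K C, EmptyOrBiDefinable R →
    RelDefinable (fun _ _ _ G u v => Relation.TransGen (fun u v => R G u v ∨ P G u v) u v : NodeRel.{a, b, c, d, e, f} L K C)

theorem plusDefinable_bot : PlusDefinable (fun _ _ _ _ _ _ => False : NodeRel.{a, b, c, d, e, f} L K C) := by
  rintro R (h | h)
  · refine TupleDefinable.bot.congr fun N Ed Eu G t => ?_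
    simp only [or_false, false_iff]
    intro h'
    rcases Relation.TransGen.head'_iff.1 h' with ⟨w, hw, -⟩
    exact h G _ _ hw
  · simpa using TupleDefinable.ofBiDefinable h.transGen (0 : Fin 2) 1

theorem PlusDefinable.congr {R R' : NodeRel.{a, b, c, d, e, f} L K C} (h : PlusDefinable R)
    (hR : ∀ ⦃N : Type a⦄ ⦃Ed : Type b⦄ ⦃Eu : Type c⦄ (G : PropertyGraph N Ed Eu L K C) u v, R G u v ↔ R' G u v) :
    PlusDefinable R' := by
  obtain rfl : R = R' := by
    funext N Ed Eu G u v
    exact propext (hR G u v)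
  exact h

/-- The guard `χ` does not depend on the nodes. If it fails, the new disjunct vanishes; if it holds,
`R'` joins the relation `R`, over which `PlusDefinable` quantifies for this purpose. -/
theorem PlusDefinable.or_guarded {P R' : NodeRel.{a, b, c, d, e, f} L K C} (hP : PlusDefinable P) (hR' : BiDefinable R')
    {χ : ∀ ⦃N : Type a⦄ ⦃Ed : Type b⦄ ⦃Eu : Type c⦄ (_ : PropertyGraph N Ed Eu L K C), Prop}
    (hχ : TupleDefinable (fun _ _ _ G _ => χ G : TupleRel.{a, b, c, d, e, f} L K C (Fin 0))) :
    PlusDefinable (fun _ _ _ G u v => P G u v ∨ (R' G u v ∧ χ G) : NodeRel.{a, b, c, d, e, f} L K C) := by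
  intro R hR
  refine ((hP R hR).or ((hχ.subst Fin.elim0).and (hP _ (hR.union (.inr hR'))))).congr ?_
  intro N Ed Eu G t
  by_cases h : χ G
  · simp only [h, true_and, and_true, or_assoc]
    constructor
    · rintro (h | h) <;> refine Relation.TransGen.mono ?_ _ _ h <;> intro u v <;> tauto
    · intro h
      right
      refine Relation.TransGen.mono ?_ _ _ h
      intro u v
      tauto
  · simp [h]

/-- `transGen_or_prod` rewrites the closure in terms of the closure of `R ∪ P`, which is definable
by `hP`, and one conjunctive combination with `φ` and `ψ`. -/
theorem PlusDefinable.or_prod {P : NodeRel.{a, b, c, d, e, f} L K C} (hP : PlusDefinable P)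
    {φ ψ : ∀ ⦃N : Type a⦄ ⦃Ed : Type b⦄ ⦃Eu : Type c⦄ (_ : PropertyGraph N Ed Eu L K C), N → Prop}
    (hφ : SetDefinable φ) (hψ : SetDefinable ψ) :
    PlusDefinable (fun _ _ _ G u v => P G u v ∨ (φ G u ∧ ψ G v) : NodeRel.{a, b, c, d, e, f} L K C) := by
  intro R hR
  have h₀ := hP R hR
  have h₁ : RelDefinable (fun _ _ _ G u v => Relation.ReflTransGen
      (fun u v => R G u v ∨ P G u v) u v : NodeRel.{a, b, c, d, e, f} L K C) :=
    ((TupleDefinable.eq 0 1).or h₀).congr fun N Ed Eu G t => by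
      beta_reduce
      rw [Relation.reflTransGen_iff_eq_or_transGen, eq_comm]
  have h₂ := ((TupleDefinable.apply₂ h₁ (.inl 0 : Fin 2 ⊕ ℕ) (.inr 0)).and
    (TupleDefinable.apply₁ hφ (.inr 0))).ex
  have h₃ := ((TupleDefinable.apply₁ hψ (.inr 0)).and
    (TupleDefinable.apply₂ h₁ (.inr 0) (.inl 1 : Fin 2 ⊕ ℕ))).ex
  refine (h₀.or (h₂.and h₃)).congr fun N Ed Eu G t => ?_
  -- `TupleDefinable.ex` binds a sequence, of which only entry `0` is used.
  have e : ∀ p : N → Prop, (∃ ν : ℕ → N, p (ν 0)) ↔ ∃ w, p w := fun p =>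
    ⟨fun ⟨ν, h⟩ => ⟨_, h⟩, fun ⟨w, h⟩ => ⟨fun _ => w, h⟩⟩
  simp only [← or_assoc, transGen_or_prod, Sum.elim_inl, Sum.elim_inr]
  rw [e fun w => Relation.ReflTransGen (fun u v => R G u v ∨ P G u v) (t 0) w ∧ φ G w,
    e fun w => ψ G w ∧ Relation.ReflTransGen (fun u v => R G u v ∨ P G u v) w (t 1)]

namespace RelAtom

open Classical in
/-- The atoms of the connected component of `x`. -/
noncomputable def component (A : List (RelAtom.{a, b, c, d, e, f} L K C ι)) (x : ι) :
    List (RelAtom.{a, b, c, d, e, f} L K C ι) := A.filter fun α => Conn A x α.x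

open Classical in
/-- The atoms outside the connected component of `x`. -/
noncomputable def coComponent (A : List (RelAtom.{a, b, c, d, e, f} L K C ι)) (x : ι) :
    List (RelAtom.{a, b, c, d, e, f} L K C ι) := A.filter fun α => ¬ Conn A x α.x

theorem mem_component {A : List (RelAtom.{a, b, c, d, e, f} L K C ι)} {x : ι}
    {α : RelAtom.{a, b, c, d, e, f} L K C ι} :
    α ∈ component A x ↔ α ∈ A ∧ Conn A x α.x := by
  simp [component]

theorem mem_coComponent {A : List (RelAtom.{a, b, c, d, e, f} L K C ι)} {x : ι}
    {α : RelAtom.{a, b, c, d, e, f} L K C ι} :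
    α ∈ coComponent A x ↔ α ∈ A ∧ ¬ Conn A x α.x := by
  simp [coComponent]

theorem conn_iff_of_mem {A : List (RelAtom.{a, b, c, d, e, f} L K C ι)} {x : ι}
    {α : RelAtom.{a, b, c, d, e, f} L K C ι} (hα : α ∈ A) : Conn A x α.x ↔ Conn A x α.y :=
  ⟨fun h => h.tail ⟨α, hα, .inl ⟨rfl, rfl⟩⟩, fun h => h.tail ⟨α, hα, .inr ⟨rfl, rfl⟩⟩⟩

/-- Every atom on a connection starting at `x` belongs to the component of `x`, so the connection
survives the filter. -/
theorem Conn.component {A : List (RelAtom.{a, b, c, d, e, f} L K C ι)} {x y : ι}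
    (h : Conn A x y) : Conn (component A x) x y := by
  induction h with
  | refl => exact .refl
  | tail h' hyz ih =>
    obtain ⟨α, hα, h⟩ := hyz
    refine ih.tail ⟨α, mem_component.2 ⟨hα, ?_⟩, h⟩
    rcases h with ⟨rfl, -⟩ | ⟨-, rfl⟩
    exacts [h', (conn_iff_of_mem hα).2 h']

-- No atom leaves the component of `x`, hence valuations inside and outside can be glued.
open Classical in
theorem holds_ite {N : Type a} {Ed : Type b} {Eu : Type c} {G : PropertyGraph N Ed Eu L K C}
    {A : List (RelAtom.{a, b, c, d, e, f} L K C ι)} {x : ι} {ρ₁ ρ₂ : ι → N}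
    (h₁ : ∀ α ∈ component A x, α.Holds G ρ₁) (h₂ : ∀ α ∈ coComponent A x, α.Holds G ρ₂) :
    ∀ α ∈ A, α.Holds G fun z => if Conn A x z then ρ₁ z else ρ₂ z := by
  intro α hα
  by_cases h : Conn A x α.x
  · simpa [Holds, h, (conn_iff_of_mem hα).1 h] using h₁ α (mem_component.2 ⟨hα, h⟩)
  · simpa [Holds, h, mt (conn_iff_of_mem hα).2 h] using h₂ α (mem_coComponent.2 ⟨hα, h⟩)

/-- The atoms outside the component mention neither `x` nor `y` and act as a Boolean guard. -/
theorem exists_holds_iff_of_conn {N : Type a} {Ed : Type b} {Eu : Type c}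
    {G : PropertyGraph N Ed Eu L K C} {A : List (RelAtom.{a, b, c, d, e, f} L K C ι)} {x y : ι}
    (h : Conn A x y) {u v : N} :
    (∃ ρ : ι → N, ρ x = u ∧ ρ y = v ∧ ∀ α ∈ A, α.Holds G ρ) ↔
      (∃ ρ : ι → N, ρ x = u ∧ ρ y = v ∧ ∀ α ∈ component A x, α.Holds G ρ) ∧
        ∃ ρ : ι → N, ∀ α ∈ coComponent A x, α.Holds G ρ := by
  constructor
  · rintro ⟨ρ, hx, hy, hρ⟩
    exact ⟨⟨ρ, hx, hy, fun α hα => hρ α (mem_component.1 hα).1⟩, ρ,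
      fun α hα => hρ α (mem_coComponent.1 hα).1⟩
  · rintro ⟨⟨ρ₁, hx, hy, h₁⟩, ρ₂, h₂⟩
    have h₀ : Conn A x x := .refl
    exact ⟨_, by simpa [h₀] using hx, by simpa [h] using hy, holds_ite h₁ h₂⟩

/-- Here `x` and `y` are constrained by disjoint parts of the query, so the relation is a product.
-/
theorem exists_holds_iff_of_not_conn {N : Type a} {Ed : Type b} {Eu : Type c}
    {G : PropertyGraph N Ed Eu L K C} {A : List (RelAtom.{a, b, c, d, e, f} L K C ι)} {x y : ι}
    (h : ¬ Conn A x y) {u v : N} :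
    (∃ ρ : ι → N, ρ x = u ∧ ρ y = v ∧ ∀ α ∈ A, α.Holds G ρ) ↔
      (∃ ρ : ι → N, ρ x = u ∧ ∀ α ∈ component A x, α.Holds G ρ) ∧
        ∃ ρ : ι → N, ρ y = v ∧ ∀ α ∈ coComponent A x, α.Holds G ρ := by
  constructor
  · rintro ⟨ρ, hx, hy, hρ⟩
    exact ⟨⟨ρ, hx, fun α hα => hρ α (mem_component.1 hα).1⟩, ρ, hy,
      fun α hα => hρ α (mem_coComponent.1 hα).1⟩
  · rintro ⟨⟨ρ₁, hx, h₁⟩, ρ₂, hy, h₂⟩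
    have h₀ : Conn A x x := .refl
    exact ⟨_, by simpa [h₀] using hx, by simpa [h] using hy, holds_ite h₁ h₂⟩

end RelAtom

open RelAtom in
theorem PlusDefinable.or_atoms [Encodable ι] {P : NodeRel.{a, b, c, d, e, f} L K C} (hP : PlusDefinable P)
    (A : List (RelAtom.{a, b, c, d, e, f} L K C ι)) (x y : ι) :
    PlusDefinable (fun _ _ _ G u v => P G u v ∨
      ∃ ρ : ι → _, ρ x = u ∧ ρ y = v ∧ ∀ α ∈ A, α.Holds G ρ : NodeRel.{a, b, c, d, e, f} L K C) := by
  have : Nonempty ι := ⟨x⟩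
  by_cases h : Conn A x y
  · refine (hP.or_guarded (biDefinable_of_conn (A := component A x) (x := x) (y := y)
      (fun α hα => (mem_component.1 hα).2.component) h.component)
      ((TupleDefinable.ofAtoms (coComponent A x) (Fin.elim0 : Fin 0 → ι)).congr
        (ψ := fun _ _ _ G _ => ∃ ρ : ι → _, ∀ α ∈ coComponent A x, α.Holds G ρ)
        fun N Ed Eu G t => by simp)).congr fun N Ed Eu G u v => ?_
    rw [exists_holds_iff_of_conn h]
  · have aux : ∀ (B : List (RelAtom.{a, b, c, d, e, f} L K C ι)) (z : ι),
        SetDefinable (fun _ _ _ G u => ∃ ρ : ι → _, ρ z = u ∧ ∀ α ∈ B, α.Holds G ρ) :=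
      fun B z => (TupleDefinable.ofAtoms B (![z] : Fin 1 → ι)).congr
        fun N Ed Eu G t => by simp
    refine (hP.or_prod (aux (component A x) x) (aux (coComponent A x) y)).congr
      fun N Ed Eu G u v => ?_
    rw [exists_holds_iff_of_not_conn h]

/-- Starting from the empty relation, the disjuncts of `Q` are added one by one with
`PlusDefinable.or_atoms`; the auxiliary relation `R` is finally taken empty. -/
theorem RelDefinable.transGen {Q : NodeRel.{a, b, c, d, e, f} L K C} (h : RelDefinable Q) :
    RelDefinable (fun _ _ _ G u v => Relation.TransGen (Q G) u v : NodeRel.{a, b, c, d, e, f} L K C) := by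
  obtain ⟨l, hl⟩ := h
  have key : PlusDefinable (fun _ _ _ G u v => ∃ A ∈ l, ∃ ρ : Fin 2 ⊕ ℕ → _,
      ρ (.inl 0) = u ∧ ρ (.inl 1) = v ∧ ∀ α ∈ A, α.Holds G ρ : NodeRel.{a, b, c, d, e, f} L K C) := by
    clear hl
    induction l with
    | nil => simpa using plusDefinable_bot
    | cons A l ih =>
      refine (ih.or_atoms A (.inl 0) (.inl 1)).congr fun N Ed Eu G u v => ?_
      simp [or_comm]
  refine (key (fun _ _ _ _ _ _ => False) (.inl fun _ _ _ _ _ _ => id)).congr fun N Ed Eu G t => ?_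
  have e : Q G = fun u v => False ∨ ∃ A ∈ l, ∃ ρ : Fin 2 ⊕ ℕ → N,
      ρ (.inl 0) = u ∧ ρ (.inl 1) = v ∧ ∀ α ∈ A, α.Holds G ρ := by
    funext u v
    refine propext ((hl G ![u, v]).trans ?_)
    rw [false_or]
    refine exists_congr fun A => and_congr_right fun _ => ⟨?_, ?_⟩
    · rintro ⟨ν, h⟩
      exact ⟨_, rfl, rfl, h⟩
    · rintro ⟨ρ, rfl, rfl, h⟩
      refine ⟨ρ ∘ Sum.inr, ?_⟩
      have e : Sum.elim ![ρ (.inl 0), ρ (.inl 1)] (ρ ∘ Sum.inr) = ρ := by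
        ext (i | i)
        · fin_cases i <;> rfl
        · rfl
      rwa [e]
  beta_reduce
  rw [e]

end Tuples

section Queries
variable {L : Type d} {K : Type e} {C : Type f}

/-! ### From unions of conjunctive queries to GPC+ -/

/-- The well-typed query `Q` has the node variables `V`, whose values in the answers are described
by `φ`. -/
structure Query.Defines (Q : Query L K C) (V : Finset Var) (φ : TupleRel.{a, b, c, d, e, f} L K C Var) : Prop where
  subset : V ⊆ Q.vars
  node : ∀ z ∈ V, Q.HasType z .node
  typed : ∀ z ∈ Q.vars, ∃ τ, Q.HasType z τ
  bound : ∀ ⦃N : Type a⦄ ⦃Ed : Type b⦄ ⦃Eu : Type c⦄ (G : PropertyGraph N Ed Eu L K C), ∀ m ∈ Q.sem G, ∀ x ∈ V,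
    ∃ u, m.2 x = some (.node u)
  sound : ∀ ⦃N : Type a⦄ ⦃Ed : Type b⦄ ⦃Eu : Type c⦄ (G : PropertyGraph N Ed Eu L K C), ∀ m ∈ Q.sem G, ∀ ν : Var → N,
    (∀ x ∈ V, m.2 x = some (.node (ν x))) → φ G ν
  complete : ∀ ⦃N : Type a⦄ ⦃Ed : Type b⦄ ⦃Eu : Type c⦄ (G : PropertyGraph N Ed Eu L K C) (ν : Var → N), φ G ν →
    ∃ m ∈ Q.sem G, ∀ x ∈ V, m.2 x = some (.node (ν x))

/-- `φ` is defined by queries with node variables `V` whose other variables are fresh. -/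
def QueryDefinable (V : Finset Var) (φ : TupleRel.{a, b, c, d, e, f} L K C Var) : Prop :=
  ∀ F : Finset Var, ∃ Q : Query L K C, Q.Defines V φ ∧ Q.vars ∩ F ⊆ V

theorem QueryDefinable.congr {V : Finset Var} {φ ψ : TupleRel.{a, b, c, d, e, f} L K C Var} (h : QueryDefinable V φ)
    (hφ : ∀ ⦃N : Type a⦄ ⦃Ed : Type b⦄ ⦃Eu : Type c⦄ (G : PropertyGraph N Ed Eu L K C) ν, φ G ν ↔ ψ G ν) :
    QueryDefinable V ψ := by
  obtain rfl : φ = ψ := by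
    funext N Ed Eu G ν
    exact propext (hφ G ν)
  exact h

theorem Query.Defines.join {Q₁ Q₂ : Query L K C} {V₁ V₂ : Finset Var} {φ₁ φ₂ : TupleRel.{a, b, c, d, e, f} L K C Var}
    (h₁ : Q₁.Defines V₁ φ₁) (h₂ : Q₂.Defines V₂ φ₂) (hV : Q₁.vars ∩ Q₂.vars ⊆ V₁ ∩ V₂) :
    (Query.join Q₁ Q₂).Defines (V₁ ∪ V₂) (fun _ _ _ G ν => φ₁ G ν ∧ φ₂ G ν) where
  subset := Finset.union_subset_union h₁.subset h₂.subset
  node z hz := by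
    have hV' : z ∈ Q₁.vars → z ∈ Q₂.vars → z ∈ V₁ ∧ z ∈ V₂ := fun a b =>
      Finset.mem_inter.1 (hV (Finset.mem_inter.2 ⟨a, b⟩))
    rcases Finset.mem_union.1 hz with hz | hz
    · by_cases h : z ∈ Q₂.vars
      · exact .inl ⟨h₁.node z hz, h₂.node z (hV' (h₁.subset hz) h).2, .inl rfl⟩
      · exact .inr (.inl ⟨h₁.node z hz, h⟩)
    · by_cases h : z ∈ Q₁.vars
      · exact .inl ⟨h₁.node z (hV' h (h₂.subset hz)).1, h₂.node z hz, .inl rfl⟩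
      · exact .inr (.inr ⟨h₂.node z hz, h⟩)
  typed z hz := by
    by_cases hz₁ : z ∈ Q₁.vars
    · by_cases hz₂ : z ∈ Q₂.vars
      · have := Finset.mem_inter.1 (hV (Finset.mem_inter.2 ⟨hz₁, hz₂⟩))
        exact ⟨.node, .inl ⟨h₁.node z this.1, h₂.node z this.2, .inl rfl⟩⟩
      · obtain ⟨τ, hτ⟩ := h₁.typed z hz₁
        exact ⟨τ, .inr (.inl ⟨hτ, hz₂⟩)⟩
    · obtain ⟨τ, hτ⟩ := h₂.typed z ((Finset.mem_union.1 hz).resolve_left hz₁)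
      exact ⟨τ, .inr (.inr ⟨hτ, hz₁⟩)⟩
  bound := by
    rintro N Ed Eu G _ ⟨p₁, μ₁, p₂, μ₂, hm₁, hm₂, hu, rfl⟩ z hz
    rcases Finset.mem_union.1 hz with hz | hz
    · obtain ⟨u, h⟩ := h₁.bound G _ hm₁ z hz
      exact ⟨u, Assignment.union_apply_of_unify hu (.inl h)⟩
    · obtain ⟨u, h⟩ := h₂.bound G _ hm₂ z hz
      exact ⟨u, Assignment.union_apply_of_unify hu (.inr h)⟩
  sound := by
    rintro N Ed Eu G _ ⟨p₁, μ₁, p₂, μ₂, hm₁, hm₂, hu, rfl⟩ ν hν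
    refine ⟨h₁.sound G _ hm₁ ν fun x hx => ?_, h₂.sound G _ hm₂ ν fun x hx => ?_⟩
    · obtain ⟨u, h⟩ := h₁.bound G _ hm₁ x hx
      exact h.trans ((Assignment.union_apply_of_unify hu (.inl h)).symm.trans
        (hν x (Finset.mem_union_left _ hx)))
    · obtain ⟨u, h⟩ := h₂.bound G _ hm₂ x hx
      exact h.trans ((Assignment.union_apply_of_unify hu (.inr h)).symm.trans
        (hν x (Finset.mem_union_right _ hx)))
  complete := by
    rintro N Ed Eu G ν ⟨hφ₁, hφ₂⟩
    obtain ⟨⟨p₁, μ₁⟩, hm₁, hν₁⟩ := h₁.complete G _ hφ₁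
    obtain ⟨⟨p₂, μ₂⟩, hm₂, hν₂⟩ := h₂.complete G _ hφ₂
    have hu : μ₁.Unify μ₂ := by
      intro x v v' hv hv'
      have hx := Finset.mem_inter.1 (hV (Finset.mem_inter.2
        ⟨Query.mem_vars_of_mem_sem hm₁ hv, Query.mem_vars_of_mem_sem hm₂ hv'⟩))
      have e₁ := hν₁ x hx.1
      have e₂ := hν₂ x hx.2
      simp only at e₁ e₂
      rw [e₁] at hv
      rw [e₂] at hv'
      exact (Option.some.inj hv).symm.trans (Option.some.inj hv')
    exact ⟨_, ⟨p₁, μ₁, p₂, μ₂, hm₁, hm₂, hu, rfl⟩, fun x hx =>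
      Assignment.union_apply_of_unify hu ((Finset.mem_union.1 hx).imp (hν₁ x) (hν₂ x))⟩

theorem QueryDefinable.join {V₁ V₂ : Finset Var} {φ₁ φ₂ : TupleRel.{a, b, c, d, e, f} L K C Var}
    (h₁ : QueryDefinable V₁ φ₁) (h₂ : QueryDefinable V₂ φ₂) :
    QueryDefinable (V₁ ∪ V₂) (fun _ _ _ G ν => φ₁ G ν ∧ φ₂ G ν : TupleRel.{a, b, c, d, e, f} L K C Var) := by
  intro F
  obtain ⟨Q₁, Q₂, hQ₁, hQ₂, hV, hF⟩ := exists_fresh h₁ h₂ F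
  exact ⟨.join Q₁ Q₂, hQ₁.join hQ₂ hV, hF⟩

theorem exists_mem_shortestOf {N Ed Eu : Type*} {S : Set (Match N Ed Eu)} {m : Match N Ed Eu}
    (hm : m ∈ S) : ∃ m' ∈ shortestOf S, m'.1.src = m.1.src ∧ m'.1.tgt = m.1.tgt := by
  let T := {m' | m' ∈ S ∧ m'.1.src = m.1.src ∧ m'.1.tgt = m.1.tgt}
  have hT : T.Nonempty := ⟨m, hm, rfl, rfl⟩
  obtain ⟨h₁, h₂, h₃⟩ := Function.argminOn_mem (fun m => m.1.len) T hT
  refine ⟨_, ⟨h₁, fun m' hm' hs ht => ?_⟩, h₂, h₃⟩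
  exact Function.argminOn_le (fun m => m.1.len) T (a := m') ⟨hm', hs.trans h₂, ht.trans h₃⟩

/-- The restrictor `shortest` is harmless if the node variables are determined by the endpoints. -/
theorem PatternDefinable.shortest {V : Finset Var} {R : PathRel.{a, b, c, d, e, f} L K C} (h : PatternDefinable V R)
    (hR : ∀ ⦃N : Type a⦄ ⦃Ed : Type b⦄ ⦃Eu : Type c⦄ (G : PropertyGraph N Ed Eu L K C) u v (ν ν' : Var → N), R G u v ν →
      R G u v ν' → ∀ x ∈ V, ν x = ν' x) :
    QueryDefinable V (fun _ _ _ G ν => ∃ u v, R G u v ν : TupleRel.{a, b, c, d, e, f} L K C Var) := by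
  intro F
  obtain ⟨π, hπ, hF⟩ := h F
  refine ⟨.pat .shortest π, ⟨hπ.subset, hπ.node, hπ.typed, ?_, ?_, ?_⟩, hF⟩
  · rintro N Ed Eu G _ ⟨p, μ, hm, rfl⟩
    exact hπ.bound G _ hm.1
  · rintro N Ed Eu G _ ⟨p, μ, hm, rfl⟩ ν hν
    exact ⟨_, _, hπ.sound G _ hm.1 ν hν⟩
  · rintro N Ed Eu G ν ⟨u, v, h⟩
    obtain ⟨m, hm, rfl, rfl, -⟩ := hπ.complete G u v ν h
    -- The shortest match may differ from `m`, but it has the same endpoints, and by `hR` these fix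
    -- the values on `V`.
    obtain ⟨m', hm', hs, ht⟩ := exists_mem_shortestOf hm
    obtain ⟨ν', hν'⟩ := hπ.exists_valuation hm'.1
    have := hπ.sound G m' hm'.1 ν' hν'
    rw [hs, ht] at this
    refine ⟨_, ⟨m'.1, m'.2, hm', rfl⟩, fun x hx => ?_⟩
    rw [hR G _ _ _ _ h this x hx]
    exact hν' x hx

/-- In the pattern `(x) π (y)` the node variables sit at the two ends, as `shortest` requires. -/
theorem BiDefinable.queryDefinable {R : NodeRel.{a, b, c, d, e, f} L K C} (h : BiDefinable R) (x y : Var) :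
    QueryDefinable ({x} ∪ (∅ ∪ {y})) (fun _ _ _ G ν => R G (ν x) (ν y) : TupleRel.{a, b, c, d, e, f} L K C Var) := by
  refine (PatternDefinable.shortest ((patternDefinable_node x).concat
    (h.1.concat (patternDefinable_node y))) ?_).congr ?_
  · rintro N Ed Eu G u v ν ν' ⟨_, ⟨h1, -⟩, _, -, -, h2⟩ ⟨_, ⟨h3, -⟩, _, -, -, h4⟩ z hz
    simp only [Finset.mem_union, Finset.mem_singleton, Finset.notMem_empty, false_or] at hz
    rcases hz with rfl | rfl
    exacts [h1.trans h3.symm, h2.trans h4.symm]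
  · rintro N Ed Eu G ν
    constructor
    · rintro ⟨_, _, _, ⟨rfl, rfl⟩, _, h, rfl, rfl⟩
      exact h
    · intro h
      exact ⟨_, _, _, ⟨rfl, rfl⟩, _, h, rfl, rfl⟩

/-- The base case is an identity atom on variable `0`. It handles the empty conjunction and ensures
that every answer binds some node. -/
theorem exists_queryDefinable (A : List (RelAtom.{a, b, c, d, e, f} L K C Var)) :
    ∃ V : Finset Var, 0 ∈ V ∧ (∀ α ∈ A, α.x ∈ V ∧ α.y ∈ V) ∧
      QueryDefinable V (fun _ _ _ G ν => ∀ α ∈ A, α.Holds G ν : TupleRel.{a, b, c, d, e, f} L K C Var) := by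
  induction A with
  | nil => exact ⟨_, by simp, by simp, (biDefinable_id.queryDefinable 0 0).congr (by simp)⟩
  | cons α A ih =>
    obtain ⟨V, h0, hV, h⟩ := ih
    refine ⟨_, ?_, ?_, ((α.biDefinable.queryDefinable α.x α.y).join h).congr
      fun N Ed Eu G ν => by simp [RelAtom.Holds]⟩
    · simp [h0]
    · intro β hβ
      rcases List.mem_cons.1 hβ with rfl | hβ
      · simp
      · exact ⟨Finset.mem_union_right _ (hV β hβ).1, Finset.mem_union_right _ (hV β hβ).2⟩

/-- The query `simple (x) → (x)` has no answers. -/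
theorem queryDefinable_false : QueryDefinable ∅ (fun _ _ _ _ _ => False : TupleRel.{a, b, c, d, e, f} L K C Var) := by
  intro F
  let x := F.sup id + 1
  have hx : x ∉ F := fun h => by
    exact absurd (Finset.le_sup (f := id) h) (Nat.not_succ_le_self _)
  refine ⟨.pat .simple (.concat (.concat (.node ⟨some x, none⟩) (.edge .forward ⟨none, none⟩))
    (.node ⟨some x, none⟩)), ?_, ?_⟩
  · have key : ∀ ⦃N : Type a⦄ ⦃Ed : Type b⦄ ⦃Eu : Type c⦄ (G : PropertyGraph N Ed Eu L K C), ∀ m, m ∉ Query.sem G (.pat .simple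
        (.concat (.concat (.node ⟨some x, none⟩) (.edge .forward ⟨none, none⟩))
        (.node ⟨some x, none⟩))) := by
      rintro N Ed Eu G _ ⟨p, μ, ⟨⟨p₁, μ₁, p₂, μ₂, ⟨p₃, μ₃, p₄, μ₄, ⟨u, -, h₃⟩,
        ⟨v, ε, w, -, -, h₄⟩, hc, hu, h₁⟩, ⟨z, -, h₂⟩, hc', hu', h⟩, hs⟩, -⟩
      simp only [Prod.mk.injEq] at h₁ h₂ h₃ h₄ h
      obtain ⟨rfl, rfl⟩ := h₃
      obtain ⟨rfl, rfl⟩ := h₄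
      obtain ⟨rfl, rfl⟩ := h₁
      obtain ⟨rfl, rfl⟩ := h₂
      obtain ⟨rfl, rfl⟩ := h
      -- The repeated variable makes the path start and end at the same node, which a simple path
      -- with one edge cannot do.
      have e := hu' x (.node u) (.node z) (by simp [Assignment.union, Assignment.bind,
        Assignment.const]) (by simp [Assignment.bind, Assignment.const])
      have e' : w = z := by rwa [GPath.Concatenates, GPath.tgt_append hc] at hc'
      simp only [Value.node.injEq] at e
      subst e e'
      simp [GPath.nodes, GPath.append, GPath.single, GPath.edge] at hs
    refine ⟨by simp, by simp, ?_, by simp, fun N Ed Eu G m hm => (key G m hm).elim,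
      fun _ _ _ _ _ h => h.elim⟩
    simp [Query.vars, Pattern.vars, Query.HasType, Pattern.HasType, Ty.IsSingleton]
  · intro z hz
    simp only [Query.vars, Pattern.vars, Finset.mem_inter, Finset.mem_union] at hz
    simp at hz
    exact absurd (hz.1 ▸ hz.2) hx

theorem Query.Defines.exists_valuation {Q : Query L K C} {V : Finset Var} {φ : TupleRel.{a, b, c, d, e, f} L K C Var}
    (h : Q.Defines V φ) {y : Var} (hy : y ∈ V) {N : Type a} {Ed : Type b} {Eu : Type c}
    {G : PropertyGraph N Ed Eu L K C} {m : List (GPath N Ed Eu) × Assignment N Ed Eu}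
    (hm : m ∈ Q.sem G) : ∃ ν : Var → N, φ G ν ∧ ∀ x ∈ V, m.2 x = some (.node (ν x)) := by
  -- The value of `y` provides the node used as default outside `V`.
  obtain ⟨w, -⟩ := h.bound G m hm y hy
  have : ∀ x, ∃ u, x ∈ V → m.2 x = some (.node u) := fun x => by
    by_cases hx : x ∈ V
    · obtain ⟨u, hu⟩ := h.bound G m hm x hx
      exact ⟨u, fun _ => hu⟩
    · exact ⟨w, fun h => absurd h hx⟩
  choose ν hν using this
  exact ⟨ν, h.sound G m hm ν hν, hν⟩

/-- Each disjunct yields a rule. The additional rule `Q'` has no answers and keeps the list of rules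
nonempty when the union is empty. -/
theorem TupleDefinable.exists_gpcPlus {n : ℕ} {φ : TupleRel.{a, b, c, d, e, f} L K C (Fin n)} (h : TupleDefinable φ) :
    ∃ g : GPCPlus L K C n, ∀ (N : Type a) (Ed : Type b) (Eu : Type c)
      (G : PropertyGraph N Ed Eu L K C), g.answers G = nodeTuples Ed Eu {t | φ G t} := by
  obtain ⟨l, hl⟩ := h
  let η : Fin n ⊕ ℕ → Var := Encodable.encode
  have hη : η.Injective := Encodable.encode_injective
  have key : ∀ A : List (RelAtom.{a, b, c, d, e, f} L K C (Fin n ⊕ ℕ)), ∃ (V : Finset Var)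
      (Q : Query L K C), 0 ∈ V ∧ (∀ i, η (.inl i) ∈ V) ∧
      Q.Defines V (fun _ _ _ G ν => ∀ α ∈ A, α.Holds G (ν ∘ η) : TupleRel.{a, b, c, d, e, f} L K C Var) := by
    intro A
    -- The trivial identity atoms make every head variable occur in the body, even if `A` does not
    -- mention it.
    obtain ⟨V, h0, hV, h⟩ := exists_queryDefinable (A.map (RelAtom.map η) ++
      (List.finRange n).map fun i => ⟨_, biDefinable_id, η (.inl i), η (.inl i)⟩)
    obtain ⟨Q, hQ, -⟩ := (h.congr (ψ := fun _ _ _ G ν => ∀ α ∈ A, α.Holds G (ν ∘ η))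
      (by simp [or_imp, forall_and, RelAtom.Holds, RelAtom.map])) ∅
    exact ⟨V, Q, h0, fun i => (hV ⟨_, biDefinable_id, η (.inl i), η (.inl i)⟩ (by simp)).1, hQ⟩
  choose V Q h0 hV hQ using key
  obtain ⟨V', Q', h0', hV', hQ'⟩ : ∃ (V : Finset Var) (Q : Query L K C), 0 ∈ V ∧
      (∀ i, η (.inl i) ∈ V) ∧ Q.Defines V (fun _ _ _ _ _ => False : TupleRel.{a, b, c, d, e, f} L K C Var) := by
    obtain ⟨W, h0, hW, h⟩ := exists_queryDefinable (L := L) (K := K) (C := C)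
      ((List.finRange n).map fun i => ⟨_, biDefinable_id, η (.inl i), η (.inl i)⟩)
    obtain ⟨Q, hQ, -⟩ := ((queryDefinable_false.join h).congr (ψ := fun _ _ _ _ _ => False)
      (by simp)) ∅
    exact ⟨_, Q, Finset.mem_union_right _ h0, fun i => Finset.mem_union_right _
      (hW ⟨_, biDefinable_id, η (.inl i), η (.inl i)⟩ (by simp)).1, hQ⟩
  refine ⟨⟨fun i => η (.inl i), Q' :: l.map Q, by simp, ?_, ?_⟩, fun N Ed Eu G => ?_⟩
  · intro q hq
    rcases List.mem_cons.1 hq with rfl | hq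
    · exact hQ'.typed
    · obtain ⟨A, -, rfl⟩ := List.mem_map.1 hq
      exact (hQ A).typed
  · intro q hq i
    rcases List.mem_cons.1 hq with rfl | hq
    · exact hQ'.subset (hV' i)
    · obtain ⟨A, -, rfl⟩ := List.mem_map.1 hq
      exact (hQ A).subset (hV A i)
  · ext t
    constructor
    · rintro ⟨q, hq, ps, μ, hm, ht⟩
      rcases List.mem_cons.1 hq with rfl | hq
      · obtain ⟨ν, hν, -⟩ := hQ'.exists_valuation h0' hm
        exact hν.elim
      · obtain ⟨A, hA, rfl⟩ := List.mem_map.1 hq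
        obtain ⟨ν, hν, hμ⟩ := (hQ A).exists_valuation (h0 A) hm
        refine ⟨fun i => ν (η (.inl i)), (hl _ _).2 ⟨A, hA, fun i => ν (η (.inr i)), ?_⟩, ?_⟩
        · intro α hα
          have e : Sum.elim (fun i => ν (η (.inl i))) (fun i => ν (η (.inr i))) = ν ∘ η := by
            ext (i | i) <;> rfl
          rw [e]
          exact hν α hα
        · funext i
          exact Option.some.inj ((hμ _ (hV A i)).symm.trans (ht i))
    · rintro ⟨t, ht, rfl⟩
      obtain ⟨A, hA, ν, h⟩ := (hl _ _).1 ht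
      -- A node is needed to extend the valuation to variables outside the range of `η`.
      have : Nonempty N := ⟨ν 0⟩
      obtain ⟨ξ, hξ⟩ := hη.surjective_comp_right (Sum.elim t ν)
      simp only at hξ
      obtain ⟨⟨ps, μ⟩, hm, hμ⟩ := (hQ A).complete G ξ (by simpa only [hξ] using h)
      refine ⟨Q A, List.mem_cons_of_mem _ (List.mem_map_of_mem hA), ps, μ, hm, fun i => ?_⟩
      refine (hμ _ (hV A i)).trans ?_
      exact congrArg (fun v => some (Value.node v)) (congrFun hξ (.inl i))

/-! ### The three query languages -/

theorem wordRel_append {N Ed Eu : Type*} {G : PropertyGraph N Ed Eu L K C}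
    {w₁ w₂ : List (Letter L)} {u v : N} :
    WordRel G (w₁ ++ w₂) u v ↔ ∃ z, WordRel G w₁ u z ∧ WordRel G w₂ z v := by
  induction w₁ generalizing u with
  | nil => simp [WordRel]
  | cons s w ih =>
    simp only [List.cons_append, WordRel, ih]
    constructor
    · rintro ⟨z, hz, y, h₁, h₂⟩
      exact ⟨y, ⟨z, hz, h₁⟩, h₂⟩
    · rintro ⟨y, ⟨z, hz, h₁⟩, h₂⟩
      exact ⟨z, hz, y, h₁, h₂⟩

theorem rpqRel_star {N Ed Eu : Type*} {G : PropertyGraph N Ed Eu L K C}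
    {r : RegularExpression (Letter L)} {u v : N} :
    RPQRel G r.star u v ↔ Relation.ReflTransGen (RPQRel G r) u v := by
  constructor
  · rintro ⟨w, hw, h⟩
    obtain ⟨S, rfl, hS⟩ := Language.mem_kstar.1 hw
    clear hw
    induction S generalizing u with
    | nil =>
      obtain rfl : u = v := h
      exact .refl
    | cons w S ih =>
      rw [List.flatten_cons, wordRel_append] at h
      obtain ⟨z, h₁, h₂⟩ := h
      exact .head ⟨w, hS w (by simp), h₁⟩ (ih (fun y hy => hS y (List.mem_cons_of_mem _ hy)) h₂)
  · intro h
    suffices ∃ S : List (List (Letter L)), (∀ y ∈ S, y ∈ r.matches') ∧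
        WordRel G S.flatten u v by
      obtain ⟨S, hS, h⟩ := this
      exact ⟨_, Language.mem_kstar.2 ⟨S, rfl, hS⟩, h⟩
    induction h using Relation.ReflTransGen.head_induction_on with
    | refl => exact ⟨[], by simp, rfl⟩
    | head h _ ih =>
      obtain ⟨w, hw, h⟩ := h
      obtain ⟨S, hS, h'⟩ := ih
      refine ⟨w :: S, fun y hy => ?_, wordRel_append.2 ⟨_, h, h'⟩⟩
      rcases List.mem_cons.1 hy with rfl | hy
      exacts [hw, hS y hy]

/-- The alternative of an empty relation is forced by the expression `0` and its composites. -/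
theorem emptyOrBiDefinable_rpqRel (r : RegularExpression (Letter L)) :
    EmptyOrBiDefinable (fun _ _ _ G u v => RPQRel G r u v : NodeRel.{a, b, c, d, e, f} L K C) := by
  induction r with
  | zero => exact .inl fun _ _ _ G u v ⟨w, hw, _⟩ => hw
  | epsilon =>
    refine EmptyOrBiDefinable.congr (.inr biDefinable_id) fun N Ed Eu G u v => ?_
    exact ⟨fun h => ⟨[], rfl, h⟩, fun ⟨w, hw, h⟩ => by
      obtain rfl : w = [] := hw
      exact h⟩
  | char s =>
    refine EmptyOrBiDefinable.congr (.inr (biDefinable_letter s)) fun N Ed Eu G u v => ?_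
    exact ⟨fun h => ⟨[s], rfl, v, h, rfl⟩, fun ⟨w, hw, h⟩ => by
      obtain rfl : w = [s] := hw
      obtain ⟨z, h, rfl⟩ := h
      exact h⟩
  | plus r₁ r₂ h₁ h₂ =>
    refine (h₁.union h₂).congr fun N Ed Eu G u v => ⟨?_, ?_⟩
    · rintro (⟨w, hw, h⟩ | ⟨w, hw, h⟩)
      exacts [⟨w, .inl hw, h⟩, ⟨w, .inr hw, h⟩]
    · rintro ⟨w, hw | hw, h⟩
      exacts [.inl ⟨w, hw, h⟩, .inr ⟨w, hw, h⟩]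
  | comp r₁ r₂ h₁ h₂ =>
    refine (h₁.comp h₂).congr fun N Ed Eu G u v => ⟨?_, ?_⟩
    · rintro ⟨z, ⟨w₁, hw₁, h₁⟩, w₂, hw₂, h₂⟩
      exact ⟨_, Language.mem_mul.2 ⟨w₁, hw₁, w₂, hw₂, rfl⟩, wordRel_append.2 ⟨z, h₁, h₂⟩⟩
    · rintro ⟨w, hw, h⟩
      obtain ⟨w₁, hw₁, w₂, hw₂, rfl⟩ := Language.mem_mul.1 hw
      obtain ⟨z, h₁, h₂⟩ := wordRel_append.1 h
      exact ⟨z, ⟨w₁, hw₁, h₁⟩, w₂, hw₂, h₂⟩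
  | star r h => exact h.reflTransGen.congr fun N Ed Eu G u v => rpqRel_star.symm

theorem tupleDefinable_uc2rpq {n : ℕ} (q : UC2RPQ L n) :
    TupleDefinable (fun _ _ _ G t => t ∈ UC2RPQ.answers q G : TupleRel.{a, b, c, d, e, f} L K C (Fin n)) := by
  refine TupleDefinable.exists_mem q fun r _ => ?_
  have h₁ : TupleDefinable (fun _ _ _ G t => ∀ i ∈ List.finRange n,
      t (.inl i) = t (.inr (r.head i)) : TupleRel.{a, b, c, d, e, f} L K C (Fin n ⊕ ℕ)) :=
    TupleDefinable.forall_mem _ fun _ _ => .eq _ _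
  have h₂ : TupleDefinable (fun _ _ _ G t => ∀ α ∈ r.body,
      RPQRel G α.r (t (.inr α.x)) (t (.inr α.y)) : TupleRel.{a, b, c, d, e, f} L K C (Fin n ⊕ ℕ)) :=
    TupleDefinable.forall_mem _ fun α _ => (emptyOrBiDefinable_rpqRel α.r).tupleDefinable _ _
  refine (h₂.and h₁).ex.congr fun N Ed Eu G t => ?_
  simp [C2RPQ.answers]

/-- A connected query with the single atom `R(0, 1)` and both endpoints at `0`: the pattern goes out
along `R` and back along its converse. -/
theorem biDefinable_test {R : NodeRel.{a, b, c, d, e, f} L K C} (h : BiDefinable R) :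
    BiDefinable (fun _ _ _ G u v => u = v ∧ ∃ z, R G u z : NodeRel.{a, b, c, d, e, f} L K C) := by
  have conn : RelAtom.Conn [(⟨R, h, 0, 1⟩ : RelAtom L K C (Fin 2))] 0 0 := .refl
  refine (RelAtom.biDefinable_of_conn (by simpa using conn) conn).congr fun N Ed Eu G u v => ?_
  constructor
  · rintro ⟨ρ, rfl, rfl, h⟩
    exact ⟨rfl, ρ 1, by simpa [RelAtom.Holds] using h⟩
  · rintro ⟨rfl, z, h⟩
    exact ⟨![u, z], rfl, rfl, by simpa [RelAtom.Holds] using h⟩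

theorem biDefinable_nre (r : NRE L) : BiDefinable (fun _ _ _ G u v => r.Rel G u v : NodeRel.{a, b, c, d, e, f} L K C) := by
  induction r with
  | eps => exact biDefinable_id
  | letter s => exact biDefinable_letter s
  | seq r₁ r₂ h₁ h₂ => exact h₁.comp h₂
  | alt r₁ r₂ h₁ h₂ => exact h₁.union h₂
  | star r h => exact h.reflTransGen
  | test r h => exact biDefinable_test h

end Queries

/-! ### Regular queries -/

namespace RegularQuery
variable {L : Type d} {K : Type e} {C : Type f} {n : ℕ}

/-- The least model of a regular query. -/
def leastModel (q : RegularQuery L n) {N Ed Eu : Type*} (G : PropertyGraph N Ed Eu L K C) (P : ℕ)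
    (t : List N) : Prop :=
  ∀ I, q.IsModel G I → I P t

theorem _root_.GPC.Atom.Holds.mono {N Ed Eu : Type*} {G : PropertyGraph N Ed Eu L K C}
    {I J : ℕ → List N → Prop} (hIJ : ∀ P t, I P t → J P t) {ν : Var → N} {α : Atom L}
    (h : α.Holds G I ν) : α.Holds G J ν := by
  cases α with
  | nodeLabel A x => exact h
  | edgeLabel l x y => exact h
  | pred P args => exact hIJ _ _ h
  | edgePlus l x y => exact h
  | predPlus P x y => exact Relation.TransGen.mono (fun _ _ => hIJ _ _) _ _ h

/-- The least model is a fixed point: the immediate consequences of the least model lie in it, and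
by monotonicity they form a model themselves. -/
theorem leastModel_iff (q : RegularQuery L n) {N Ed Eu : Type*}
    (G : PropertyGraph N Ed Eu L K C) (P : ℕ) (t : List N) :
    q.leastModel G P t ↔ ∃ r ∈ q.rules, r.headPred = P ∧ ∃ ν : Var → N,
      (∀ α ∈ r.body, α.Holds G (q.leastModel G) ν) ∧ t = r.headArgs.map ν := by
  have key : ∀ P t, (∃ r ∈ q.rules, r.headPred = P ∧ ∃ ν : Var → N,
      (∀ α ∈ r.body, α.Holds G (q.leastModel G) ν) ∧ t = r.headArgs.map ν) →
      q.leastModel G P t := by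
    rintro _ _ ⟨r, hr, rfl, ν, h, rfl⟩ I hI
    exact hI r hr ν fun α hα => (h α hα).mono fun P t h => h I hI
  refine ⟨fun h => h (fun P t => ∃ r ∈ q.rules, r.headPred = P ∧ ∃ ν : Var → N,
    (∀ α ∈ r.body, α.Holds G (q.leastModel G) ν) ∧ t = r.headArgs.map ν)
    fun r hr ν hν => ?_, key P t⟩
  exact ⟨r, hr, rfl, ν, fun α hα => (hν α hα).mono key, rfl⟩

/-- The predicates occurring in rule bodies. -/
def usedPreds (q : RegularQuery L n) : Set ℕ := {P | ∃ r ∈ q.rules, ∃ α ∈ r.body, α.Uses P}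

theorem finite_usedPreds (q : RegularQuery L n) : q.usedPreds.Finite := by
  have : q.usedPreds = ⋃ r ∈ q.rules, ⋃ α ∈ r.body, {P | α.Uses P} := by
    ext P
    simp [usedPreds]
  rw [this]
  refine (List.finite_toSet q.rules).biUnion fun r _ =>
    (List.finite_toSet r.body).biUnion fun α _ => Set.Subsingleton.finite ?_
  intro P hP Q hQ
  cases α <;> simp_all [Atom.Uses]

/-- The dependency relation between predicates. -/
def Dep (q : RegularQuery L n) (Q R : ℕ) : Prop :=
  ∃ r ∈ q.rules, r.headPred = R ∧ ∃ α ∈ r.body, α.Uses Q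

/-- A predicate is ranked by the number of used predicates on which it depends. The restriction to
used predicates makes this finite, and nonrecursiveness makes it grow strictly along dependencies.
-/
theorem wellFounded_dep (q : RegularQuery L n) : WellFounded q.Dep := by
  let rank : ℕ → ℕ := fun P => {Q | Q ∈ q.usedPreds ∧ Relation.TransGen q.Dep Q P}.ncard
  refine Subrelation.wf (r := InvImage (· < ·) rank) ?_ (InvImage.wf rank Nat.lt_wfRel.wf)
  intro P Q h
  refine Set.ncard_lt_ncard ⟨fun R hR => ⟨hR.1, hR.2.tail h⟩, fun hs => ?_⟩
    (q.finite_usedPreds.subset fun R hR => hR.1)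
  have hP : P ∈ q.usedPreds := by
    obtain ⟨r, hr, -, α, hα, hu⟩ := h
    exact ⟨r, hr, α, hα, hu⟩
  exact q.nonrecursive P (hs ⟨hP, .single h⟩).2

/-- Only the atom `P⁺(x, y)` needs more than substitution: it rests on `RelDefinable.transGen`. -/
theorem tupleDefinable_holds (q : RegularQuery L n) {κ : Type} (g : ℕ → κ) (α : Atom L)
    (h : ∀ P, α.Uses P → ∀ k,
      TupleDefinable (fun _ _ _ G t => q.leastModel G P (List.ofFn t) : TupleRel.{a, b, c, d, e, f} L K C (Fin k))) :
    TupleDefinable (fun _ _ _ G t => α.Holds G (q.leastModel G) (t ∘ g) : TupleRel.{a, b, c, d, e, f} L K C κ) := by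
  cases α with
  | nodeLabel A x =>
    exact (TupleDefinable.ofBiDefinable (biDefinable_label A) (g x) (g x)).congr
      fun N Ed Eu G t => by simp [Atom.Holds]
  | edgeLabel l x y => exact .ofBiDefinable (biDefinable_edge l) (g x) (g y)
  | pred P args =>
    refine ((h P rfl args.length).subst fun i => g (args.get i)).congr fun N Ed Eu G t => ?_
    simp only [Atom.Holds]
    have e : List.ofFn (t ∘ fun i => g (args.get i)) = args.map (t ∘ g) := by
      conv_rhs => rw [← List.ofFn_get args, List.map_ofFn]
      rfl
    rw [e]
  | edgePlus l x y => exact .ofBiDefinable (biDefinable_edge l).transGen (g x) (g y)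
  | predPlus P x y =>
    have h₂ : RelDefinable (fun _ _ _ G u v => q.leastModel G P [u, v] : NodeRel.{a, b, c, d, e, f} L K C) :=
      (h P rfl 2).congr fun N Ed Eu G t => by simp
    exact TupleDefinable.apply₂ h₂.transGen (g x) (g y)

/-- Induction along dependencies: the body atoms of a rule for `P` use earlier predicates only, so
the rule is an existentially quantified conjunction of definable relations. -/
theorem tupleDefinable_leastModel (q : RegularQuery L n) (P k : ℕ) :
    TupleDefinable (fun _ _ _ G t => q.leastModel G P (List.ofFn t) : TupleRel.{a, b, c, d, e, f} L K C (Fin k)) := by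
  induction P using q.wellFounded_dep.induction generalizing k with
  | _ P ih =>
  have key : ∀ r ∈ q.rules, TupleDefinable (fun _ _ _ G t => r.headPred = P ∧ ∃ ν : Var → _,
      (∀ α ∈ r.body, α.Holds G (q.leastModel G) ν) ∧ List.ofFn t = r.headArgs.map ν :
      TupleRel.{a, b, c, d, e, f} L K C (Fin k)) := by
    intro r hr
    by_cases hP : r.headPred = P
    · by_cases hk : r.headArgs.length = k
      · subst hk
        have h₁ : TupleDefinable (fun _ _ _ G t => ∀ α ∈ r.body,
            α.Holds G (q.leastModel G) (t ∘ Sum.inr) : TupleRel.{a, b, c, d, e, f} L K C (Fin r.headArgs.length ⊕ ℕ)) :=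
          TupleDefinable.forall_mem _ fun α hα => q.tupleDefinable_holds Sum.inr α
            fun Q hQ => ih Q ⟨r, hr, hP, α, hα, hQ⟩
        have h₂ : TupleDefinable (fun _ _ _ G t => ∀ i ∈ List.finRange r.headArgs.length,
            t (.inl i) = t (.inr (r.headArgs.get i)) : TupleRel.{a, b, c, d, e, f} L K C (Fin r.headArgs.length ⊕ ℕ)) :=
          TupleDefinable.forall_mem _ fun _ _ => .eq _ _
        refine (h₁.and h₂).ex.congr fun N Ed Eu G t => ?_
        simp only [hP, true_and, List.mem_finRange, true_imp_iff]
        refine exists_congr fun ν => and_congr_right fun _ => ?_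
        rw [List.ext_get_iff]
        simp [Fin.forall_iff]
      -- A rule whose head has a length other than `k` derives no `k`-tuple.
      · refine TupleDefinable.bot.congr fun N Ed Eu G t => ?_
        simp only [false_iff]
        rintro ⟨-, ν, -, h⟩
        exact hk (by simpa using (congrArg List.length h).symm)
    · exact TupleDefinable.bot.congr fun N Ed Eu G t => by simp [hP]
  exact (TupleDefinable.exists_mem q.rules key).congr fun N Ed Eu G t =>
    (q.leastModel_iff G P (List.ofFn t)).symm

end RegularQuery

end GPC

theorem mainTheorem3 (L K C : Type*) :
    (∀ (n : ℕ) (q : GPC.UC2RPQ L n), ∃ g : GPC.GPCPlus L K C n,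
      ∀ (N Ed Eu : Type*) (G : GPC.PropertyGraph N Ed Eu L K C),
        g.answers G = GPC.nodeTuples Ed Eu (GPC.UC2RPQ.answers q G)) ∧
    (∀ e : GPC.NRE L, ∃ g : GPC.GPCPlus L K C 2,
      ∀ (N Ed Eu : Type*) (G : GPC.PropertyGraph N Ed Eu L K C),
        g.answers G = GPC.nodeTuples Ed Eu (e.answers G)) ∧
    (∀ (n : ℕ) (q : GPC.RegularQuery L n), ∃ g : GPC.GPCPlus L K C n,
      ∀ (N Ed Eu : Type*) (G : GPC.PropertyGraph N Ed Eu L K C),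
        g.answers G = GPC.nodeTuples Ed Eu (q.answers G)) :=
  ⟨fun _ q => (GPC.tupleDefinable_uc2rpq q).exists_gpcPlus,
    fun r => (GPC.TupleDefinable.ofBiDefinable (GPC.biDefinable_nre r) 0 1).exists_gpcPlus,
    fun n q => (q.tupleDefinable_leastModel q.ans n).exists_gpcPlus⟩
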